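/- Let $d\ge 1$, $p>1$ and $q=p/(p-1)$. For $s\ge 1$ write $\|x\|_s=(\sum_i|x_i|^s)^{1/s}$ on $\mathbb R^d$, and let $x^{\otimes a}$ denote the component-wise power (for negative components, $\operatorname{sign}(x_i)|x_i|^a$). Let $\mathcal L_p$ be the law on $\mathbb R_+$ with density $\frac{p}{\Gamma(1/p)}e^{-x^p}$. *Reference distribution.* Let $U_{d,q}$ be the law of $R\,\Phi$ with $R$ uniform on $[0,1]$, independent of $\Phi=\Psi^{\otimes(p-1)}$, where $\Psi$ is uniform on $\{\|\cdot\|_p=1\}$, i.e. has the law of $Z/\|Z\|_p$ for $Z$ uniform on the unit ball of $\|\cdot\|_p$. Let $U^+_{d,q}$ be the restriction of $U_{d,q}$ to $\mathbb R^d_+$, normalized to a probability measure. *MK maps.* An MK quantile function of $\nu$ with respect to $\mu$ is a map $Q$ with $Q_\#\mu=\nu$ that is $\mu$-a.e. the gradient of a convex function with values in $(-\infty,+\infty]$. An MK distribution function of $\nu$ with respect to $\mu$ is a map $F$ that is $\nu$-a.e. the gradient of such a convex function, satisfies $F_\#\nu=\mu$, and is the (a.e. two-sided) inverse of an MK quantile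 function. For a quantile function $Q$, the superquantile and expected shortfall functions are $$S(u)=\frac1{1-\|u\|_q}\int_{\|u\|_q}^1Q\Big(t\tfrac{u}{\|u\|_q}\Big)dt,\qquad E(u)=\frac1{\|u\|_q}\int_0^{\|u\|_q}Q\Big(t\tfrac{u}{\|u\|_q}\Big)dt .$$ *Statement.* Let $X$ be a random vector in $\mathbb R^d$ with independent components of law $\mathcal L_p$, let $\nu$ be its law, let $G$ be the distribution function of $\|X\|_p$, and let $G^{-1}(\alpha)=\inf\{x: G(x)\ge\alpha\}$. Let $\overline S(\alpha)=\mathbb E[\,\|X\|_p \mid \|X\|_p\ge G^{-1}(\alpha)]$ and $\overline E(\alpha)=\mathbb E[\,\|X\|_p\mid \|X\|_p\le G^{-1}(\alpha)]$ for $0<\alpha<1$. Put $$F_q(x)=\Big(\frac{x}{\|x\|_p}\Big)^{\otimes(p-1)}G(\|x\|_p),\qquad Q_q(u)=\Big(\frac{u}{\|u\|_q}\Big)^{\otimes(q-1)}G^{-1}(\|u\|_q),$$ for $x\neq 0$ and $0<\|u\|_q<1$. Then: 1. $F_q$ is an MK distribution function of $\nu$ with respect to $U^+_{d,q}$, and any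 gradient of a convex function pushing $\nu$ to $U^+_{d,q}$ equals $F_q$ $\nu$-a.e. 2. $Q_q$ is an MK quantile function of $\nu$ with respect to $U^+_{d,q}$, and any other one equals $Q_q$ $U^+_{d,q}$-a.e. Moreover there is a convex $\psi$ on $\{\|u\|_q<1\}$ with $\psi(0)=0$ and $\nabla\psi(u)=Q_q(u)$ for every $u\in\mathbb R^d_+$ with $0<\|u\|_q<1$. 3. $F_q$ is a bijection from $\mathbb R^d_+\setminus\{0\}$ onto $\{u\in\mathbb R^d_+: 0<\|u\|_q<1\}$ with inverse $Q_q$. 4. For every $u\in\mathbb R^d_+$ with $0<\|u\|_q<1$, $t\mapsto Q_q(tu/\|u\|_q)$ is integrable on $[0,1]$, and the superquantile function $S_q$ and expected shortfall function $E_q$ of $Q_q$ satisfy $$S_q(u)=\Big(\frac{u}{\|u\|_q}\Big)^{\otimes(q-1)}\overline S(\|u\|_q),\qquad E_q(u)=\Big(\frac{u}{\|u\|_q}\Big)^{\otimes(q-1)}\overline E(\|u\|_q).$$ For $u\in\mathbb R^d_+$ with $\|u\|_q=1$ one has $E_q(u)=u^{\otimes(q-1)}\,\mathbb E\|X\|_p$,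 with finite expectation and convergent integral. 5. For any other MK quantile function of $\nu$ with respect to $U^+_{d,q}$, its integrals along rays converge and its superquantile and expected shortfall functions are given by the formulas of 4 for $U^+_{d,q}$-almost every $u$. -/

import Mathlib

open MeasureTheory ProbabilityTheory Set

noncomputable section

namespace MK

/-- `ℝ^d` with its Euclidean inner product. -/
abbrev Vec (d : ℕ) : Type := EuclideanSpace ℝ (Fin d)

/-- The `p`-norm `(∑ |x_i|^p)^(1/p)` on `ℝ^d`. -/
def pNorm {d : ℕ} (p : ℝ) (x : Vec d) : ℝ := (∑ i, |x i| ^ p) ^ (1 / p)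

/-- The closed nonnegative orthant `ℝ^d_+`. -/
def orthant (d : ℕ) : Set (Vec d) := {x | ∀ i, 0 ≤ x i}

/-- The component-wise exponent `x^{⊗ a}`: its `i`-th component is `x_i ^ a` when `0 ≤ x_i` (with
`a > 0`), extended to negative components as the odd function `sign(x_i) |x_i| ^ a`. -/
def compPow {d : ℕ} (a : ℝ) (x : Vec d) : Vec d :=
  WithLp.toLp 2 fun i => Real.sign (x i) * |x i| ^ a

/-- The uniform (normalized cone) probability measure on the `p`-unit sphere of `ℝ^d`: the law of
`x / ‖x‖_p` when `x` is uniformly distributed on the `p`-unit ball. -/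
def uniformSphere (d : ℕ) (p : ℝ) : Measure (Vec d) :=
  (cond volume {x : Vec d | pNorm p x ≤ 1}).map fun x => (pNorm p x)⁻¹ • x

/-- The `q`-spherical conjugate distribution `U_{d,q}`: the law of `R • Φ`, where `R` is uniform on
`[0,1]` and independent of `Φ = Ψ^{⊗(p-1)}`, with `p = q/(q-1)` the conjugate exponent of `q` and
`Ψ` uniform on the `p`-unit sphere. -/
def conjSpherical (d : ℕ) (q : ℝ) : Measure (Vec d) :=
  ((volume.restrict (Icc (0 : ℝ) 1)).prod
    ((uniformSphere d (q / (q - 1))).map (compPow (q / (q - 1) - 1)))).map fun z => z.1 • z.2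

/-- `U^+_{d,q}`: the (renormalized) restriction of `U_{d,q}` to `ℝ^d_+`. -/
def conjSphericalPos (d : ℕ) (q : ℝ) : Measure (Vec d) :=
  cond (conjSpherical d q) (orthant d)

/-- The law `L_p` on `ℝ_+`, with density `p / Γ(1/p) * exp(-x^p)` on `ℝ_+`. -/
def genGammaLaw (p : ℝ) : Measure ℝ :=
  volume.withDensity fun x =>
    ENNReal.ofReal ((Ici (0 : ℝ)).indicator (fun x => p / Real.Gamma p⁻¹ * Real.exp (-x ^ p)) x)

/-- `Q` is a Monge-Kantorovich quantile function of `ν` with respect to the reference distribution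
`μ`: it pushes `μ` forward to `ν` and is `μ`-a.e. the gradient of a convex potential `ψ`. The
potential takes values in `(-∞, +∞]`; it is given by its domain `C`, a convex set, and a finite
convex function on `C`. -/
structure IsMKQuantile {d : ℕ} (μ ν : Measure (Vec d)) (Q : Vec d → Vec d) : Prop where
  aemeasurable : AEMeasurable Q μ
  map_eq : μ.map Q = ν
  exists_potential : ∃ (C : Set (Vec d)) (ψ : Vec d → ℝ), ConvexOn ℝ C ψ ∧
    ∀ᵐ u ∂μ, u ∈ interior C ∧ HasGradientAt ψ (Q u) u

/-- `F` is a Monge-Kantorovich distribution function of `ν` with respect to the reference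
distribution `μ`: it is the inverse of an MK quantile function, and it is itself the gradient of a
convex function that pushes `ν` forward to `μ`. -/
structure IsMKDistribution {d : ℕ} (μ ν : Measure (Vec d)) (F : Vec d → Vec d) : Prop where
  transport : IsMKQuantile ν μ F
  inverse : ∃ Q : Vec d → Vec d, IsMKQuantile μ ν Q ∧
    (∀ᵐ u ∂μ, F (Q u) = u) ∧ (∀ᵐ x ∂ν, Q (F x) = x)

/-- The superquantile function `S_q` built from the quantile function `Q`. -/
def superquantile {d : ℕ} (q : ℝ) (Q : Vec d → Vec d) (u : Vec d) : Vec d :=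
  (1 / (1 - pNorm q u)) • ∫ t in (pNorm q u)..1, Q (t • (pNorm q u)⁻¹ • u)

/-- The expected shortfall function `E_q` built from the quantile function `Q`. -/
def expectedShortfall {d : ℕ} (q : ℝ) (Q : Vec d → Vec d) (u : Vec d) : Vec d :=
  (1 / pNorm q u) • ∫ t in (0 : ℝ)..(pNorm q u), Q (t • (pNorm q u)⁻¹ • u)

/-- The univariate quantile function `α ↦ inf {x | α ≤ G x}` of the law `ρ`, where `G` is the
distribution function of `ρ` (used for `0 < α < 1`). -/
def quantile₁ (ρ : Measure ℝ) (α : ℝ) : ℝ := sInf {x : ℝ | α ≤ cdf ρ x}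

/-- The univariate superquantile `E[Y | Y ≥ Q(α)]` for `Y` with law `ρ`. -/
def superquantile₁ (ρ : Measure ℝ) (α : ℝ) : ℝ :=
  (∫ y in Ici (quantile₁ ρ α), y ∂ρ) / ρ.real (Ici (quantile₁ ρ α))

/-- The univariate expected shortfall `E[Y | Y ≤ Q(α)]` for `Y` with law `ρ`. -/
def expectedShortfall₁ (ρ : Measure ℝ) (α : ℝ) : ℝ :=
  (∫ y in Iic (quantile₁ ρ α), y ∂ρ) / ρ.real (Iic (quantile₁ ρ α))

end MK

end

/-!
The components of `X` have densities proportional to `exp (-x ^ p)`, so the law `ν` of `X` has a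
density on the orthant that depends on `x` through `‖x‖_p` only (`map_eq_withDensity_pNorm`).
Homogeneity of the volume then makes `‖X‖_p` and the direction `X / ‖X‖_p` independent, the
direction having the cone measure of the `p`-sphere restricted to the orthant
(`map_pNorm_direction`). As the law of `‖X‖_p` has no atoms and charges every interval of the
half-line (`isFullHalfLine_map_pNorm`), its distribution function `G` turns `‖X‖_p` into a uniform
variable, so that `F (X)` is a uniform radius times an independent component-wise power of a uniform
direction: this is the reference distribution (`map_radialMap_cdf`).

Away from the origin, `‖·‖_p` has gradient `(x / ‖x‖_p)^{⊗(p-1)}` (`hasGradientAt_pNorm`). Hence `F`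
is the gradient of `x ↦ ∫₀^{‖x‖_p} G` and `Q` is the gradient of `u ↦ ∫₀^{‖u‖_q} G⁻¹`; both
potentials are convex, being compositions of a norm with an increasing convex function. The maps
`F` and `Q` are inverse to each other because `t ↦ t ^ (p-1)` and `t ↦ t ^ (q-1)` are, and because
the former power maps the `p`-sphere to the `q`-sphere (`radialMap_radialMap`).

Uniqueness follows Brenier's duality argument (`IsMKQuantile.ae_eq`). If `T = ∇φ` and `T'` push `μ`
to the same law, then integrating Young's inequality `⟪x, T' x⟫ ≤ φ x + φ* (T' x)`, which is an
equality for `T`, shows `∫ ⟪x, T' x⟫ ≤ ∫ ⟪x, T x⟫`. If `T'` is also a gradient of a convex function,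
the reverse inequality holds, so Young's inequality is an equality almost everywhere, `T' x` is a
subgradient of `φ` at `x`, and differentiability of `φ` at `x` gives `T' x = T x`. Since one of the
two laws is bounded and the other has a first moment, all integrals converge.

Along a ray `Q` has a constant direction and radial part `G⁻¹`, so superquantile and expected
shortfall reduce to integrals of `G⁻¹`, which pushes the uniform law to the law of `‖X‖_p`. Any
other version of `Q` agrees with it almost everywhere, hence, by Fubini's theorem, almost everywhere
on almost every ray (`ae_ray`).
-/

/-! ### The `p`-norms and the duality between conjugate exponents -/

namespace MK

section Norm

variable {d : ℕ} {p q : ℝ}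

lemma pNorm_nonneg (p : ℝ) (x : Vec d) : 0 ≤ pNorm p x := by
  unfold pNorm; positivity

lemma pNorm_rpow (hp : 0 < p) (x : Vec d) : pNorm p x ^ p = ∑ i, |x i| ^ p := by
  unfold pNorm
  rw [← Real.rpow_mul (by positivity), one_div_mul_cancel hp.ne', Real.rpow_one]

lemma pNorm_zero (hp : 0 < p) : pNorm p (0 : Vec d) = 0 := by
  simp [pNorm, Real.zero_rpow hp.ne', hp.ne']

lemma abs_le_pNorm (hp : 0 < p) (x : Vec d) (i : Fin d) : |x i| ≤ pNorm p x := by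
  rw [← Real.rpow_le_rpow_iff (abs_nonneg _) (pNorm_nonneg _ _) hp, pNorm_rpow hp]
  exact Finset.single_le_sum (f := fun i => |x i| ^ p) (fun i _ => by positivity) (Finset.mem_univ i)

lemma pNorm_pos (hp : 0 < p) {x : Vec d} (hx : x ≠ 0) : 0 < pNorm p x := by
  refine (pNorm_nonneg p x).lt_of_ne' fun h => hx ?_
  ext i
  have := abs_le_pNorm hp x i
  rw [h] at this
  simpa using this

lemma ne_zero_of_pNorm_pos (hp : 0 < p) {x : Vec d} (hx : 0 < pNorm p x) : x ≠ 0 := by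
  rintro rfl
  rw [pNorm_zero hp] at hx
  exact lt_irrefl _ hx

lemma pNorm_smul (hp : 0 < p) (c : ℝ) (x : Vec d) : pNorm p (c • x) = |c| * pNorm p x := by
  unfold pNorm
  have : ∀ i, |(c • x) i| ^ p = |c| ^ p * |x i| ^ p := fun i => by
    rw [PiLp.smul_apply, smul_eq_mul, abs_mul, Real.mul_rpow (abs_nonneg _) (abs_nonneg _)]
  simp_rw [this]
  rw [← Finset.mul_sum, Real.mul_rpow (by positivity) (by positivity),
    ← Real.rpow_mul (abs_nonneg _), mul_one_div_cancel hp.ne', Real.rpow_one]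

lemma pNorm_inv_smul (hp : 0 < p) {x : Vec d} (hx : x ≠ 0) :
    pNorm p ((pNorm p x)⁻¹ • x) = 1 := by
  rw [pNorm_smul hp, abs_of_nonneg (inv_nonneg.2 (pNorm_nonneg _ _)),
    inv_mul_cancel₀ (pNorm_pos hp hx).ne']

lemma pNorm_add_le (hp : 1 ≤ p) (x y : Vec d) : pNorm p (x + y) ≤ pNorm p x + pNorm p y :=
  Real.Lp_add_le Finset.univ (fun i => x i) (fun i => y i) hp

lemma convexOn_pNorm (hp : 1 ≤ p) : ConvexOn ℝ univ (pNorm (d := d) p) := by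
  refine ⟨convex_univ, fun x _ y _ a b ha hb _ => (pNorm_add_le hp _ _).trans_eq ?_⟩
  rw [pNorm_smul (by linarith), pNorm_smul (by linarith), abs_of_nonneg ha, abs_of_nonneg hb,
    smul_eq_mul, smul_eq_mul]

lemma continuous_pNorm (hp : 0 < p) : Continuous (pNorm (d := d) p) := by
  unfold pNorm
  refine Continuous.rpow_const (continuous_finsetSum _ fun i _ => Continuous.rpow_const
    (by fun_prop) fun _ => Or.inr hp.le) fun _ => Or.inr (by positivity)

lemma measurable_pNorm (hp : 0 < p) : Measurable (pNorm (d := d) p) :=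
  (continuous_pNorm hp).measurable

lemma pNorm_le_sum (hp : 1 ≤ p) (x : Vec d) : pNorm p x ≤ ∑ i, |x i| := by
  have hp0 : 0 < p := by linarith
  have hx : x = ∑ i, EuclideanSpace.single i (x i) := by
    ext j
    simp [Finset.sum_apply]
  have h1 : ∀ i (c : ℝ), pNorm p (EuclideanSpace.single i c : Vec d) = |c| := by
    intro i c
    unfold pNorm
    rw [Finset.sum_eq_single i]
    · rw [PiLp.single_apply, if_pos rfl, ← Real.rpow_mul (abs_nonneg _),
        mul_one_div_cancel hp0.ne', Real.rpow_one]
    · intro j _ hj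
      simp [hj, Real.zero_rpow hp0.ne']
    · simp
  conv_lhs => rw [hx]
  refine (Finset.le_sum_of_subadditive (pNorm p) (pNorm_zero hp0).le (pNorm_add_le hp) _ _).trans ?_
  simp [h1]

/-! ### Component-wise powers -/

lemma compPow_apply (a : ℝ) (x : Vec d) (i : Fin d) :
    compPow a x i = Real.sign (x i) * |x i| ^ a := rfl

lemma abs_sign_mul_rpow {a : ℝ} (ha : 0 < a) (t : ℝ) : |Real.sign t * |t| ^ a| = |t| ^ a := by
  rcases lt_trichotomy t 0 with h | h | h
  · rw [Real.sign_of_neg h, neg_one_mul, abs_neg, abs_of_nonneg (by positivity)]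
  · simp [h, Real.zero_rpow ha.ne']
  · rw [Real.sign_of_pos h, one_mul, abs_of_nonneg (by positivity)]

lemma sign_sign_mul_rpow (a t : ℝ) : Real.sign (Real.sign t * |t| ^ a) = Real.sign t := by
  rcases lt_trichotomy t 0 with h | h | h
  · rw [Real.sign_of_neg h, neg_one_mul, Real.sign_of_neg]
    have := Real.rpow_pos_of_pos (abs_pos.2 h.ne) a
    linarith
  · simp [h]
  · rw [Real.sign_of_pos h, one_mul, Real.sign_of_pos]
    exact Real.rpow_pos_of_pos (abs_pos.2 h.ne') a

lemma sign_mul_abs_self (t : ℝ) : Real.sign t * |t| = t := by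
  rcases lt_trichotomy t 0 with h | h | h
  · rw [Real.sign_of_neg h, abs_of_neg h]; ring
  · simp [h]
  · rw [Real.sign_of_pos h, abs_of_pos h]; ring

lemma compPow_compPow {a b : ℝ} (ha : 0 < a) (hab : a * b = 1) (x : Vec d) :
    compPow b (compPow a x) = x := by
  ext i
  rw [compPow_apply, compPow_apply, sign_sign_mul_rpow, abs_sign_mul_rpow ha,
    ← Real.rpow_mul (abs_nonneg _), hab, Real.rpow_one, sign_mul_abs_self]

lemma pNorm_compPow {a : ℝ} (ha : 0 < a) (hpq : a * q = p) {x : Vec d} (hx : pNorm p x = 1)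
    (hp : 0 < p) : pNorm q (compPow a x) = 1 := by
  have : ∑ i, |compPow a x i| ^ q = 1 := by
    simp_rw [compPow_apply, abs_sign_mul_rpow ha, ← Real.rpow_mul (abs_nonneg _), hpq]
    rw [← pNorm_rpow hp, hx, Real.one_rpow]
  rw [pNorm, this, Real.one_rpow]

lemma measurable_compPow (a : ℝ) : Measurable (compPow (d := d) a) := by
  have h : Measurable Real.sign := by
    unfold Real.sign
    exact Measurable.ite measurableSet_Iio measurable_const
      (Measurable.ite measurableSet_Ioi measurable_const measurable_const)
  unfold compPow
  fun_prop

lemma compPow_mem_orthant {a : ℝ} {x : Vec d} :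
    compPow a x ∈ orthant d ↔ x ∈ orthant d := by
  refine forall_congr' fun i => ?_
  rw [compPow_apply]
  rcases lt_trichotomy (x i) 0 with h | h | h
  · have := Real.rpow_pos_of_pos (abs_pos.2 h.ne) a
    rw [Real.sign_of_neg h]
    constructor <;> intro h' <;> linarith
  · simp [h]
  · rw [Real.sign_of_pos h]
    exact ⟨fun _ => h.le, fun _ => by positivity⟩

lemma smul_mem_orthant {c : ℝ} (hc : 0 < c) {x : Vec d} : c • x ∈ orthant d ↔ x ∈ orthant d :=
  forall_congr' fun i => by rw [PiLp.smul_apply, smul_eq_mul, mul_nonneg_iff_of_pos_left hc]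

lemma measurableSet_orthant : MeasurableSet (orthant d) := by
  unfold orthant
  simp_rw [ofPred_forall]
  exact MeasurableSet.iInter fun i => measurableSet_le measurable_const (by fun_prop)

/-- Away from the origin, the `p`-norm is differentiable, and its gradient is the component-wise
power of exponent `p - 1` of the direction. -/
lemma hasGradientAt_pNorm (hp : 1 < p) {x : Vec d} (hx : x ≠ 0) :
    HasGradientAt (pNorm p) (compPow (p - 1) ((pNorm p x)⁻¹ • x)) x := by
  have hp0 : 0 < p := by linarith
  have hN := pNorm_pos hp0 hx
  have hS : 0 < ∑ i, |x i| ^ p := by rw [← pNorm_rpow hp0]; positivity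
  have h1 : HasFDerivAt (fun y : Vec d => ∑ i, |y i| ^ p)
      (∑ i, (p * |x i| ^ (p - 2) * x i) • (EuclideanSpace.proj i : Vec d →L[ℝ] ℝ)) x :=
    HasFDerivAt.fun_sum fun i _ =>
      HasDerivAt.comp_hasFDerivAt (h₂ := fun t : ℝ => |t| ^ p) x (hasDerivAt_abs_rpow (x i) hp)
        (EuclideanSpace.proj i : Vec d →L[ℝ] ℝ).hasFDerivAt
  have h2 := (Real.hasDerivAt_rpow_const (p := 1 / p) (Or.inl hS.ne')).comp_hasFDerivAt x h1
  rw [hasGradientAt_iff_hasFDerivAt]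
  refine h2.congr_fderiv ?_
  ext v
  rw [InnerProductSpace.toDual_apply_apply, PiLp.inner_apply]
  simp only [smul_apply, sum_apply, smul_eq_mul,
    Finset.mul_sum]
  refine Finset.sum_congr rfl fun i _ => ?_
  rw [compPow_apply, PiLp.smul_apply, smul_eq_mul]
  have e1 : (∑ i, |x i| ^ p) ^ (1 / p - 1) = (pNorm p x)⁻¹ ^ (p - 1) := by
    rw [← pNorm_rpow hp0, ← Real.rpow_mul hN.le, Real.inv_rpow hN.le, ← Real.rpow_neg hN.le]
    congr 1
    field_simp
    ring
  have e2 : Real.sign ((pNorm p x)⁻¹ * x i) = Real.sign (x i) := by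
    rcases lt_trichotomy (x i) 0 with h | h | h
    · rw [Real.sign_of_neg h, Real.sign_of_neg (mul_neg_of_pos_of_neg (inv_pos.2 hN) h)]
    · simp [h]
    · rw [Real.sign_of_pos h, Real.sign_of_pos (mul_pos (inv_pos.2 hN) h)]
  have e3 : |x i| ^ (p - 2) * x i = Real.sign (x i) * |x i| ^ (p - 1) := by
    rcases eq_or_ne (x i) 0 with h | h
    · simp [h]
    · conv_lhs => rw [← sign_mul_abs_self (x i), mul_left_comm]
      have : |x i| ^ (p - 1) = |x i| ^ (p - 2) * |x i| := by
        rw [← Real.rpow_add_one (abs_pos.2 h).ne']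
        congr 1; ring
      rw [this, sign_mul_abs_self]
  have e4 : (1 / p) * p = 1 := one_div_mul_cancel hp0.ne'
  rw [e1, e2, abs_mul, abs_of_pos (inv_pos.2 hN), Real.mul_rpow (inv_pos.2 hN).le (abs_nonneg _)]
  simp only [PiLp.proj_apply, RCLike.inner_apply, conj_trivial]
  calc 1 / p * (pNorm p x)⁻¹ ^ (p - 1) * (p * |x i| ^ (p - 2) * x i * v i)
      = ((1 / p) * p) * (pNorm p x)⁻¹ ^ (p - 1) * (|x i| ^ (p - 2) * x i) * v i := by ring
    _ = _ := by rw [e3, e4]; ring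

/-- Chain rule for radial potentials. -/
lemma hasGradientAt_comp_pNorm (hp : 1 < p) {x : Vec d} (hx : x ≠ 0) {h : ℝ → ℝ} {h' : ℝ}
    (hh : HasDerivAt h h' (pNorm p x)) :
    HasGradientAt (fun y => h (pNorm p y)) (h' • compPow (p - 1) ((pNorm p x)⁻¹ • x)) x := by
  have := hh.comp_hasFDerivAt x (hasGradientAt_pNorm hp hx).hasFDerivAt
  rw [hasGradientAt_iff_hasFDerivAt]
  refine this.congr_fderiv ?_
  simp

end Norm

end MK

/-! ### Uniqueness of gradients of convex functions with a given push-forward -/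

namespace MK

section Uniqueness

variable {d : ℕ}

/-- The subgradient inequality for a convex function at a point of differentiability. -/
lemma add_inner_le_of_hasGradientAt {C : Set (Vec d)} {ψ : Vec d → ℝ} (hψ : ConvexOn ℝ C ψ)
    {u g y : Vec d} (hu : u ∈ C) (hg : HasGradientAt ψ g u) (hy : y ∈ C) :
    ψ u + inner ℝ g (y - u) ≤ ψ y := by
  have h1 : HasDerivAt (fun t : ℝ => ψ (u + t • (y - u))) (inner ℝ g (y - u)) 0 := by
    have h2 : HasDerivAt (fun t : ℝ => u + t • (y - u)) (y - u) 0 := by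
      simpa using ((hasDerivAt_id (0 : ℝ)).smul_const (y - u)).const_add u
    have h3 : HasFDerivAt ψ (InnerProductSpace.toDual ℝ _ g) (u + (0 : ℝ) • (y - u)) := by
      simpa using hg.hasFDerivAt
    simpa [Function.comp_def] using h3.comp_hasDerivAt (0 : ℝ) h2
  have hc : ConvexOn ℝ (Icc (0 : ℝ) 1) (fun t : ℝ => ψ (u + t • (y - u))) := by
    have := hψ.comp_affineMap (AffineMap.lineMap u y : ℝ →ᵃ[ℝ] Vec d)
    have h4 : (ψ ∘ (AffineMap.lineMap u y : ℝ →ᵃ[ℝ] Vec d)) = fun t : ℝ => ψ (u + t • (y - u)) := by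
      ext t
      simp [AffineMap.lineMap_apply, add_comm]
    rw [h4] at this
    refine this.subset (fun t ht => ?_) (convex_Icc 0 1)
    exact hψ.1.segment_subset hu hy (by
      rw [segment_eq_image_lineMap]; exact mem_image_of_mem _ ht)
  have := hc.le_slope_of_hasDerivAt (x := 0) (y := 1) (by simp) (by simp) one_pos h1
  simp [slope_def_field] at this
  linarith

/-- A subgradient at an interior point of differentiability is the gradient. -/
lemma eq_of_forall_add_inner_le {C : Set (Vec d)} {ψ : Vec d → ℝ} {u g v : Vec d}
    (hu : u ∈ interior C) (hg : HasGradientAt ψ g u)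
    (h : ∀ y ∈ C, ψ u + inner ℝ v (y - u) ≤ ψ y) : v = g := by
  have hmin : IsLocalMin (fun y => ψ y - inner ℝ v (y - u)) u := by
    filter_upwards [isOpen_interior.mem_nhds hu] with y hy
    have := h y (interior_subset hy)
    simp only [sub_self, inner_zero_right]
    linarith
  have hd : HasFDerivAt (fun y => ψ y - inner ℝ v (y - u))
      (InnerProductSpace.toDual ℝ _ g - InnerProductSpace.toDual ℝ _ v) u := by
    refine hg.hasFDerivAt.sub ?_
    have : HasFDerivAt (fun y : Vec d => (InnerProductSpace.toDual ℝ (Vec d) v) (y - u))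
        (InnerProductSpace.toDual ℝ _ v) u := by
      simpa [Function.comp_def] using (InnerProductSpace.toDual ℝ (Vec d) v).hasFDerivAt.comp u
        ((hasFDerivAt_id u).sub_const u)
    simpa using this
  have := hmin.hasFDerivAt_eq_zero hd
  exact ((InnerProductSpace.toDual ℝ (Vec d)).injective (sub_eq_zero.1 this)).symm

/-- The Legendre conjugate of the function which is `φ` on `C` and `+∞` elsewhere. -/
noncomputable def conjugate (C : Set (Vec d)) (φ : Vec d → ℝ) (v : Vec d) : EReal :=
  ⨆ x ∈ C, ((inner ℝ x v - φ x : ℝ) : EReal)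

lemma measurable_conjugate (C : Set (Vec d)) (φ : Vec d → ℝ) : Measurable (conjugate C φ) := by
  refine LowerSemicontinuous.measurable (lowerSemicontinuous_biSup fun x _ => ?_)
  refine Continuous.lowerSemicontinuous ?_
  exact continuous_coe_real_ereal.comp (by fun_prop)

/-- Young's inequality, where the conjugate is finite. -/
lemma inner_le_add_conjugate {C : Set (Vec d)} {φ : Vec d → ℝ} {x v : Vec d} (hx : x ∈ C)
    (hv : conjugate C φ v ≠ ⊤) : inner ℝ x v ≤ φ x + (conjugate C φ v).toReal := by
  have h : ((inner ℝ x v - φ x : ℝ) : EReal) ≤ conjugate C φ v :=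
    le_iSup₂ (f := fun x (_ : x ∈ C) => ((inner ℝ x v - φ x : ℝ) : EReal)) x hx
  have := EReal.toReal_le_toReal h (EReal.coe_ne_bot _) hv
  rw [EReal.toReal_coe] at this
  linarith

/-- Young's equality at a point of differentiability. -/
lemma conjugate_gradient {C : Set (Vec d)} {φ : Vec d → ℝ} (hφ : ConvexOn ℝ C φ)
    {x g : Vec d} (hx : x ∈ C) (hg : HasGradientAt φ g x) :
    conjugate C φ g = ((inner ℝ x g - φ x : ℝ) : EReal) := by
  refine le_antisymm (iSup₂_le fun y hy => ?_)
    (le_iSup₂ (f := fun x (_ : x ∈ C) => ((inner ℝ x g - φ x : ℝ) : EReal)) x hx)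
  have := add_inner_le_of_hasGradientAt hφ hx hg hy
  rw [inner_sub_right, real_inner_comm, real_inner_comm x g] at this
  exact_mod_cast by linarith

variable {μ ν : Measure (Vec d)} {T T' : Vec d → Vec d}

/-- A gradient `T` of a convex function maximizes the correlation `∫ ⟪x, T' x⟫` among the maps with
the same push-forward, and the subgradient inequality is saturated if `T'` has the same
correlation. -/
lemma IsMKQuantile.inner_le [IsProbabilityMeasure μ] (hT : IsMKQuantile μ ν T)
    (hT' : AEMeasurable T' μ) (hmap : μ.map T' = ν)
    (hμ : Integrable (fun x => ‖x‖) μ) (hν : Integrable (fun x => ‖x‖) ν)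
    (hi : Integrable (fun x => inner ℝ x (T x)) μ)
    (hi' : Integrable (fun x => inner ℝ x (T' x)) μ) :
    ∫ x, inner ℝ x (T' x) ∂μ ≤ ∫ x, inner ℝ x (T x) ∂μ ∧
    (∫ x, inner ℝ x (T' x) ∂μ = ∫ x, inner ℝ x (T x) ∂μ → T' =ᵐ[μ] T) := by
  obtain ⟨C, φ, hφ, hC⟩ := hT.exists_potential
  have hTm := hT.aemeasurable
  have hTmap := hT.map_eq
  set γ : Vec d → ℝ := fun v => (conjugate C φ v).toReal with hγ
  have hγm : Measurable γ := (measurable_conjugate C φ).ereal_toReal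
  -- the potential agrees almost everywhere with a measurable function
  have hφm : AEStronglyMeasurable φ μ := by
    refine ⟨(interior C).indicator φ, ?_, ?_⟩
    · have hc : ContinuousOn φ (interior C) := hφ.continuousOn_interior
      have : Measurable ((interior C).indicator φ) := by
        classical
        rw [← piecewise_eq_indicator]
        exact hc.measurable_piecewise continuousOn_const isOpen_interior.measurableSet
      exact this.stronglyMeasurable
    · filter_upwards [hC] with x hx
      rw [indicator_of_mem hx.1]
  have heq : ∀ᵐ x ∂μ, φ x + γ (T x) = inner ℝ x (T x) := by
    filter_upwards [hC] with x hx
    rw [hγ]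
    simp only [conjugate_gradient hφ (interior_subset hx.1) hx.2, EReal.toReal_coe]
    ring
  have hfinν : ∀ᵐ v ∂ν, conjugate C φ v ≠ ⊤ := by
    have hm : MeasurableSet {v | conjugate C φ v ≠ ⊤} :=
      ((measurable_conjugate C φ) (measurableSet_singleton ⊤)).compl
    rw [← hTmap, ae_map_iff hTm hm]
    filter_upwards [hC] with x hx
    rw [conjugate_gradient hφ (interior_subset hx.1) hx.2]
    exact EReal.coe_ne_top _
  have hfin : ∀ᵐ x ∂μ, conjugate C φ (T' x) ≠ ⊤ := ae_of_ae_map hT' (hmap ▸ hfinν)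
  have hge : ∀ᵐ x ∂μ, inner ℝ x (T' x) ≤ φ x + γ (T' x) := by
    filter_upwards [hC, hfin] with x hx hx'
    exact inner_le_add_conjugate (interior_subset hx.1) hx'
  obtain ⟨x₀, hx₀⟩ := hC.exists
  have hx₀C := interior_subset hx₀.1
  -- affine minorants of the potential and of its conjugate, both anchored at `x₀`
  have hlow : ∀ᵐ x ∂μ, φ x₀ - ‖T x₀‖ * ‖x‖ - ‖T x₀‖ * ‖x₀‖ ≤ φ x := by
    filter_upwards [hC] with x hx
    have h1 := add_inner_le_of_hasGradientAt hφ hx₀C hx₀.2 (interior_subset hx.1)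
    have h2 := neg_le_of_abs_le (abs_real_inner_le_norm (T x₀) (x - x₀))
    have h3 := mul_le_mul_of_nonneg_left (norm_sub_le x x₀) (norm_nonneg (T x₀))
    linarith
  have hlow' : ∀ᵐ x ∂μ, - ‖x₀‖ * ‖T x‖ - φ x₀ ≤ γ (T x) := by
    filter_upwards [ae_of_ae_map hTm (hTmap ▸ hfinν)] with x hx
    have h1 := inner_le_add_conjugate hx₀C hx
    have h2 := neg_le_of_abs_le (abs_real_inner_le_norm x₀ (T x))
    simp only [hγ]
    linarith
  have hTi : Integrable (fun x => ‖T x‖) μ := by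
    rw [← hTmap] at hν
    exact hν.comp_aemeasurable hTm
  -- being squeezed between integrable functions, the potential and its conjugate are integrable
  have hφi : Integrable φ μ := by
    refine integrable_of_le_of_le hφm hlow (?_ : φ ≤ᵐ[μ]
      fun x => inner ℝ x (T x) + (‖x₀‖ * ‖T x‖ + φ x₀)) ?_ ?_
    · filter_upwards [heq, hlow'] with x h1 h2
      linarith
    · exact ((integrable_const _).sub (hμ.const_mul _)).sub (integrable_const _)
    · exact hi.add ((hTi.const_mul _).add (integrable_const _))
  have hγT : Integrable (fun x => γ (T x)) μ := by
    refine (hi.sub hφi).congr ?_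
    filter_upwards [heq] with x hx
    simp only [Pi.sub_apply]
    linarith
  have hγν : Integrable γ ν := by
    rw [← hTmap]
    exact (integrable_map_measure hγm.aestronglyMeasurable hTm).2 hγT
  have hγT' : Integrable (fun x => γ (T' x)) μ := by
    rw [← hmap] at hγν
    exact hγν.comp_aemeasurable hT'
  have hγeq : ∫ x, γ (T' x) ∂μ = ∫ x, γ (T x) ∂μ := by
    rw [← integral_map hT' hγm.aestronglyMeasurable, ← integral_map hTm hγm.aestronglyMeasurable,
      hmap, hTmap]
  have hval : ∫ x, (φ x + γ (T' x)) ∂μ = ∫ x, inner ℝ x (T x) ∂μ := by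
    rw [integral_add hφi hγT', hγeq, ← integral_add hφi hγT]
    exact integral_congr_ae heq
  refine ⟨hval ▸ integral_mono_ae hi' (hφi.add hγT') hge, fun h => ?_⟩
  have hsat := (integral_eq_iff_of_ae_le hi' (hφi.add hγT') hge).1 (h.trans hval.symm)
  filter_upwards [hsat, hC, hfin] with x h1 h2 h3
  refine eq_of_forall_add_inner_le h2.1 h2.2 fun y hy => ?_
  have h4 := inner_le_add_conjugate hy h3
  simp only [Pi.add_apply] at h1
  rw [inner_sub_right, real_inner_comm, real_inner_comm x]
  simp only [hγ] at h1
  linarith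

/-- Under first moment conditions, a gradient of a convex function is determined almost everywhere
by its push-forward. -/
theorem IsMKQuantile.ae_eq [IsProbabilityMeasure μ] (hT : IsMKQuantile μ ν T)
    (hT' : IsMKQuantile μ ν T')
    (hμ : Integrable (fun x => ‖x‖) μ) (hν : Integrable (fun x => ‖x‖) ν)
    (hi : Integrable (fun x => inner ℝ x (T x)) μ)
    (hi' : Integrable (fun x => inner ℝ x (T' x)) μ) : T' =ᵐ[μ] T := by
  have h1 := hT.inner_le hT'.aemeasurable hT'.map_eq hμ hν hi hi'
  have h2 := hT'.inner_le hT.aemeasurable hT.map_eq hμ hν hi' hi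
  exact h1.2 (le_antisymm h1.1 h2.1)

end Uniqueness

end MK

/-! ### Quantiles of an atomless law on the half-line with full support -/

namespace MK

open Filter Topology

lemma continuous_cdf (ρ : Measure ℝ) [IsProbabilityMeasure ρ] [NullSingletonClass ρ] :
    Continuous (cdf ρ) := by
  refine continuous_iff_continuousAt.2 fun x => ?_
  rw [(monotone_cdf ρ).continuousAt_iff_leftLim_eq_rightLim, StieltjesFunction.rightLim_eq]
  have h1 : (cdf ρ).measure {x} = 0 := by rw [measure_cdf, measure_singleton]
  rw [StieltjesFunction.measure_singleton, ENNReal.ofReal_eq_zero] at h1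
  exact le_antisymm ((monotone_cdf ρ).leftLim_le le_rfl) (by linarith)

lemma quantile₁_of_nonpos (ρ : Measure ℝ) {α : ℝ} (hα : α ≤ 0) : quantile₁ ρ α = 0 := by
  have : {x : ℝ | α ≤ cdf ρ x} = univ := eq_univ_of_forall fun x => hα.trans (cdf_nonneg ρ x)
  rw [quantile₁, this, Real.sInf_univ]

/-- A law on `ℝ` carried by the half-line, without atoms, which charges every interval of the
half-line: its distribution function is a homeomorphism from `[0, ∞)` onto `[0, 1)`. -/
structure IsFullHalfLine (ρ : Measure ℝ) : Prop where
  isProb : IsProbabilityMeasure ρ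
  noAtoms : NullSingletonClass ρ
  nonpos_null : ρ (Iic 0) = 0
  pos : ∀ a b, 0 ≤ a → a < b → 0 < ρ (Ioc a b)

namespace IsFullHalfLine

variable {ρ : Measure ℝ}

lemma cdf_zero (h : IsFullHalfLine ρ) : cdf ρ 0 = 0 := by
  have := h.isProb
  rw [cdf_eq_real, measureReal_def, h.nonpos_null, ENNReal.toReal_zero]

lemma strictMonoOn_cdf (h : IsFullHalfLine ρ) : StrictMonoOn (cdf ρ) (Ici 0) := by
  intro a ha b _ hab
  have h1 := h.pos a b ha hab
  have := h.isProb
  rw [← measure_cdf ρ, StieltjesFunction.measure_Ioc, ENNReal.ofReal_pos] at h1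
  linarith

lemma cdf_lt_one (h : IsFullHalfLine ρ) (x : ℝ) : cdf ρ x < 1 :=
  ((monotone_cdf ρ (le_max_left x 0)).trans_lt
    (h.strictMonoOn_cdf (mem_Ici.2 (le_max_right x 0))
      (mem_Ici.2 ((le_max_right x 0).trans (by linarith))) (lt_add_one _))).trans_le
    (cdf_le_one ρ (max x 0 + 1))

lemma cdf_pos (h : IsFullHalfLine ρ) {x : ℝ} (hx : 0 < x) : 0 < cdf ρ x := by
  rw [← h.cdf_zero]
  exact h.strictMonoOn_cdf (mem_Ici.2 le_rfl) (mem_Ici.2 hx.le) hx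

lemma cdf_le_cdf_iff (h : IsFullHalfLine ρ) {x r : ℝ} (hr : 0 ≤ r) :
    cdf ρ x ≤ cdf ρ r ↔ x ≤ r := by
  refine ⟨fun hx => ?_, fun hx => monotone_cdf ρ hx⟩
  by_contra! hlt
  exact absurd (h.strictMonoOn_cdf hr (mem_Ici.2 (hr.trans hlt.le)) hlt) hx.not_gt

lemma quantile₁_cdf (h : IsFullHalfLine ρ) {r : ℝ} (hr : 0 ≤ r) :
    quantile₁ ρ (cdf ρ r) = r := by
  rcases hr.eq_or_lt with rfl | hr
  · rw [h.cdf_zero, quantile₁_of_nonpos ρ le_rfl]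
  · have : {x : ℝ | cdf ρ r ≤ cdf ρ x} = Ici r := by
      ext x
      refine ⟨fun hx => ?_, fun hx => monotone_cdf ρ hx⟩
      by_contra hlt
      rw [mem_Ici, not_le] at hlt
      -- a point below `r` has a smaller value of the distribution function, on either side of `0`
      have h1 : cdf ρ (max x 0) < cdf ρ r :=
        h.strictMonoOn_cdf (mem_Ici.2 (le_max_right _ _)) (mem_Ici.2 hr.le) (max_lt hlt hr)
      exact absurd ((monotone_cdf ρ (le_max_left x 0)).trans_lt h1) (not_lt.2 hx)
    rw [quantile₁, this, csInf_Ici]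

lemma exists_cdf_eq (h : IsFullHalfLine ρ) {α : ℝ} (h0 : 0 ≤ α) (h1 : α < 1) :
    ∃ r, 0 ≤ r ∧ cdf ρ r = α := by
  have := h.isProb
  have := h.noAtoms
  obtain ⟨b, hb⟩ := ((tendsto_cdf_atTop ρ).eventually (lt_mem_nhds h1)).exists
  have hb0 : 0 ≤ b := by
    by_contra! hlt
    have := monotone_cdf ρ hlt.le
    rw [h.cdf_zero] at this
    linarith
  obtain ⟨r, hr, hrα⟩ := intermediate_value_Icc hb0 (continuous_cdf ρ).continuousOn
    (⟨h.cdf_zero.trans_le h0, hb.le⟩ : α ∈ Icc (cdf ρ 0) (cdf ρ b))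
  exact ⟨r, hr.1, hrα⟩

lemma cdf_quantile₁ (h : IsFullHalfLine ρ) {α : ℝ} (h0 : 0 ≤ α) (h1 : α < 1) :
    cdf ρ (quantile₁ ρ α) = α := by
  obtain ⟨r, hr, rfl⟩ := h.exists_cdf_eq h0 h1
  rw [h.quantile₁_cdf hr]

lemma quantile₁_of_one_le (h : IsFullHalfLine ρ) {α : ℝ} (hα : 1 ≤ α) : quantile₁ ρ α = 0 := by
  have : {x : ℝ | α ≤ cdf ρ x} = ∅ :=
    eq_empty_of_forall_notMem fun x hx => ((h.cdf_lt_one x).trans_le hα).not_ge hx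
  rw [quantile₁, this, Real.sInf_empty]

lemma quantile₁_nonneg (h : IsFullHalfLine ρ) (α : ℝ) : 0 ≤ quantile₁ ρ α := by
  rcases le_total α 0 with h0 | h0
  · rw [quantile₁_of_nonpos ρ h0]
  rcases le_or_gt 1 α with h1 | h1
  · rw [h.quantile₁_of_one_le h1]
  obtain ⟨r, hr, rfl⟩ := h.exists_cdf_eq h0 h1
  rwa [h.quantile₁_cdf hr]

lemma strictMonoOn_quantile₁ (h : IsFullHalfLine ρ) : StrictMonoOn (quantile₁ ρ) (Ico 0 1) := by
  intro a ha b hb hab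
  obtain ⟨r, hr, rfl⟩ := h.exists_cdf_eq ha.1 ha.2
  obtain ⟨s, hs, rfl⟩ := h.exists_cdf_eq hb.1 hb.2
  rw [h.quantile₁_cdf hr, h.quantile₁_cdf hs]
  by_contra! hle
  exact absurd (monotone_cdf ρ hle) hab.not_ge

lemma quantile₁_pos (h : IsFullHalfLine ρ) {α : ℝ} (h0 : 0 < α) (h1 : α < 1) :
    0 < quantile₁ ρ α := by
  rw [← quantile₁_of_nonpos ρ le_rfl]
  exact h.strictMonoOn_quantile₁ (by simp) ⟨h0.le, h1⟩ h0

lemma continuousAt_quantile₁ (h : IsFullHalfLine ρ) {α : ℝ} (h0 : 0 < α) (h1 : α < 1) :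
    ContinuousAt (quantile₁ ρ) α := by
  refine StrictMonoOn.continuousAt_of_image_mem_nhds h.strictMonoOn_quantile₁
    (Ico_mem_nhds h0 h1) ?_
  have : quantile₁ ρ '' Ico 0 1 = Ici 0 := by
    refine subset_antisymm (image_subset_iff.2 fun x _ => h.quantile₁_nonneg x) fun r hr => ?_
    exact ⟨cdf ρ r, ⟨cdf_nonneg ρ r, h.cdf_lt_one r⟩, h.quantile₁_cdf hr⟩
  rw [this]
  exact Ici_mem_nhds (h.quantile₁_pos h0 h1)

lemma measurable_quantile₁ (h : IsFullHalfLine ρ) : Measurable (quantile₁ ρ) := by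
  classical
  have : quantile₁ ρ = (Ioo (0 : ℝ) 1).piecewise (quantile₁ ρ) (fun _ => 0) := by
    ext α
    by_cases hα : α ∈ Ioo (0 : ℝ) 1
    · rw [piecewise_eq_of_mem _ _ _ hα]
    · rw [piecewise_eq_of_notMem _ _ _ hα]
      rcases le_or_gt α 0 with h0 | h0
      · exact quantile₁_of_nonpos ρ h0
      · exact h.quantile₁_of_one_le (not_lt.1 fun h1 => hα ⟨h0, h1⟩)
  rw [this]
  refine ContinuousOn.measurable_piecewise (fun α hα => ?_) continuousOn_const measurableSet_Ioo
  exact (h.continuousAt_quantile₁ hα.1 hα.2).continuousWithinAt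

/-- The probability integral transform. -/
lemma map_cdf (h : IsFullHalfLine ρ) : ρ.map (cdf ρ) = volume.restrict (Icc (0 : ℝ) 1) := by
  have := h.isProb
  have hm : Measurable (cdf ρ) := (monotone_cdf ρ).measurable
  have : IsProbabilityMeasure (ρ.map (cdf ρ)) := Measure.isProbabilityMeasure_map hm.aemeasurable
  refine Measure.ext_of_Iic _ _ fun a => ?_
  rw [Measure.map_apply hm measurableSet_Iic, Measure.restrict_apply measurableSet_Iic]
  rcases lt_or_ge a 0 with h0 | h0
  · have e1 : cdf ρ ⁻¹' Iic a = ∅ :=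
      eq_empty_of_forall_notMem fun x hx => (h0.trans_le (cdf_nonneg ρ x)).not_ge hx
    have e2 : Iic a ∩ Icc 0 1 = ∅ :=
      eq_empty_of_forall_notMem fun x hx => (h0.trans_le hx.2.1).not_ge hx.1
    rw [e1, e2, measure_empty, measure_empty]
  rcases le_or_gt 1 a with h1 | h1
  · have e1 : cdf ρ ⁻¹' Iic a = univ := eq_univ_of_forall fun x => (cdf_le_one ρ x).trans h1
    have e2 : Iic a ∩ Icc 0 1 = Icc 0 1 := inter_eq_right.2 fun x hx => hx.2.trans h1
    rw [e1, e2, measure_univ, Real.volume_Icc]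
    simp
  · obtain ⟨r, hr, rfl⟩ := h.exists_cdf_eq h0 h1
    have e1 : cdf ρ ⁻¹' Iic (cdf ρ r) = Iic r := by
      ext x
      exact h.cdf_le_cdf_iff hr
    have e2 : Iic (cdf ρ r) ∩ Icc 0 1 = Icc 0 (cdf ρ r) := by
      ext x
      simp only [mem_inter_iff, mem_Iic, mem_Icc]
      exact ⟨fun hx => ⟨hx.2.1, hx.1⟩, fun hx => ⟨hx.2, hx.1, hx.2.trans h1.le⟩⟩
    rw [e1, e2, Real.volume_Icc, sub_zero, ofReal_cdf]

lemma ae_pos (h : IsFullHalfLine ρ) : ∀ᵐ r ∂ρ, 0 < r := by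
  rw [ae_iff]
  simpa [Iic] using h.nonpos_null

/-- The quantile function pushes the uniform law on `[0, 1]` to the law itself. -/
lemma map_quantile₁ (h : IsFullHalfLine ρ) :
    (volume.restrict (Icc (0 : ℝ) 1)).map (quantile₁ ρ) = ρ := by
  rw [← h.map_cdf, Measure.map_map h.measurable_quantile₁ (monotone_cdf ρ).measurable]
  have : (quantile₁ ρ ∘ cdf ρ) =ᵐ[ρ] id := by
    filter_upwards [h.ae_pos] with r hr using h.quantile₁_cdf hr.le
  rw [Measure.map_congr this, Measure.map_id]

lemma setIntegral_id (h : IsFullHalfLine ρ) {s : Set ℝ} (hs : MeasurableSet s) :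
    ∫ y in s, y ∂ρ = ∫ t in quantile₁ ρ ⁻¹' s ∩ Icc 0 1, quantile₁ ρ t := by
  conv_lhs => rw [← h.map_quantile₁]
  rw [setIntegral_map (f := fun y : ℝ => y) hs aestronglyMeasurable_id h.measurable_quantile₁.aemeasurable,
    Measure.restrict_restrict (h.measurable_quantile₁ hs)]

lemma intervalIntegrable_quantile₁ (h : IsFullHalfLine ρ) (hi : Integrable (fun y => y) ρ)
    {a b : ℝ} (ha : a ∈ Icc (0 : ℝ) 1) (hb : b ∈ Icc (0 : ℝ) 1) :
    IntervalIntegrable (quantile₁ ρ) volume a b := by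
  rw [← h.map_quantile₁] at hi
  have h1 : IntegrableOn (quantile₁ ρ) (Icc 0 1) := hi.comp_aemeasurable
    h.measurable_quantile₁.aemeasurable
  rw [intervalIntegrable_iff]
  exact h1.mono_set (uIoc_subset_uIcc.trans (uIcc_subset_Icc ha hb))

lemma integral_quantile₁ (h : IsFullHalfLine ρ) :
    ∫ t in (0 : ℝ)..1, quantile₁ ρ t = ∫ y, y ∂ρ := by
  have := h.setIntegral_id MeasurableSet.univ
  rw [setIntegral_univ, preimage_univ, univ_inter] at this
  rw [this, intervalIntegral.integral_of_le zero_le_one, integral_Icc_eq_integral_Ioc]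

lemma superquantile₁_eq (h : IsFullHalfLine ρ) {α : ℝ} (h0 : 0 < α) (h1 : α < 1) :
    superquantile₁ ρ α = (1 / (1 - α)) * ∫ t in α..1, quantile₁ ρ t := by
  have hset : quantile₁ ρ ⁻¹' Ici (quantile₁ ρ α) ∩ Icc 0 1 = Ico α 1 := by
    ext t
    simp only [mem_inter_iff, mem_preimage, mem_Ici, mem_Icc, mem_Ico]
    constructor
    · rintro ⟨h2, h3, h4⟩
      have h5 : t < 1 := by
        refine h4.lt_of_ne ?_
        rintro rfl
        rw [h.quantile₁_of_one_le le_rfl] at h2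
        exact absurd (h.quantile₁_pos h0 h1) h2.not_gt
      exact ⟨(h.strictMonoOn_quantile₁.le_iff_le ⟨h0.le, h1⟩ ⟨h3, h5⟩).1 h2, h5⟩
    · rintro ⟨h2, h3⟩
      have h4 : 0 ≤ t := h0.le.trans h2
      exact ⟨(h.strictMonoOn_quantile₁.le_iff_le ⟨h0.le, h1⟩ ⟨h4, h3⟩).2 h2, h4, h3.le⟩
  have hmass : ρ.real (Ici (quantile₁ ρ α)) = 1 - α := by
    rw [measureReal_def]
    nth_rw 1 [← h.map_quantile₁]
    rw [Measure.map_apply h.measurable_quantile₁ measurableSet_Ici,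
      Measure.restrict_apply (h.measurable_quantile₁ measurableSet_Ici), hset, Real.volume_Ico,
      ENNReal.toReal_ofReal (by linarith)]
  rw [superquantile₁, hmass, h.setIntegral_id measurableSet_Ici, hset,
    intervalIntegral.integral_of_le h1.le, integral_Ico_eq_integral_Ioo,
    integral_Ioc_eq_integral_Ioo, div_eq_inv_mul, one_div]

lemma expectedShortfall₁_eq (h : IsFullHalfLine ρ) {α : ℝ} (h0 : 0 < α) (h1 : α < 1) :
    expectedShortfall₁ ρ α = (1 / α) * ∫ t in (0 : ℝ)..α, quantile₁ ρ t := by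
  have := h.isProb
  -- the endpoint `1`, where the infimum is over the empty set, is a null set
  have hset : (quantile₁ ρ ⁻¹' Iic (quantile₁ ρ α) ∩ Icc 0 1 : Set ℝ) =ᵐ[volume] Ioc 0 α := by
    have hne : ∀ s : ℝ, ∀ᵐ t : ℝ, t ≠ s := fun s => by
      rw [ae_iff]; simp
    filter_upwards [hne 0, hne 1] with t ht0 ht1
    refine propext (⟨?_, ?_⟩ : t ∈ (quantile₁ ρ ⁻¹' Iic (quantile₁ ρ α) ∩ Icc 0 1 : Set ℝ) ↔
      t ∈ Ioc 0 α)
    · rintro ⟨h2, h3, h4⟩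
      exact ⟨h3.lt_of_ne' ht0,
        (h.strictMonoOn_quantile₁.le_iff_le ⟨h3, h4.lt_of_ne ht1⟩ ⟨h0.le, h1⟩).1 h2⟩
    · rintro ⟨h2, h3⟩
      exact ⟨(h.strictMonoOn_quantile₁.le_iff_le ⟨h2.le, h3.trans_lt h1⟩ ⟨h0.le, h1⟩).2 h3,
        h2.le, (h3.trans_lt h1).le⟩
  rw [expectedShortfall₁, ← cdf_eq_real, h.cdf_quantile₁ h0.le h1,
    h.setIntegral_id measurableSet_Iic, setIntegral_congr_set hset,
    intervalIntegral.integral_of_le h0.le, div_eq_inv_mul, one_div]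

lemma hasDerivAt_integral_cdf (h : IsFullHalfLine ρ) (r : ℝ) :
    HasDerivAt (fun r => ∫ s in (0 : ℝ)..r, cdf ρ s) (cdf ρ r) r := by
  have := h.isProb
  have := h.noAtoms
  have hc := continuous_cdf ρ
  exact intervalIntegral.integral_hasDerivAt_right (hc.intervalIntegrable _ _)
    hc.aestronglyMeasurable.stronglyMeasurableAtFilter hc.continuousAt

lemma monotone_integral_cdf (h : IsFullHalfLine ρ) :
    Monotone (fun r => ∫ s in (0 : ℝ)..r, cdf ρ s) :=
  monotone_of_hasDerivAt_nonneg h.hasDerivAt_integral_cdf fun r => cdf_nonneg ρ r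

lemma convexOn_integral_cdf (h : IsFullHalfLine ρ) :
    ConvexOn ℝ univ (fun r => ∫ s in (0 : ℝ)..r, cdf ρ s) := by
  refine Monotone.convexOn_univ_of_deriv (fun r => (h.hasDerivAt_integral_cdf r).differentiableAt) ?_
  have : deriv (fun r => ∫ s in (0 : ℝ)..r, cdf ρ s) = cdf ρ :=
    funext fun r => (h.hasDerivAt_integral_cdf r).deriv
  rw [this]
  exact monotone_cdf ρ

lemma hasDerivAt_integral_quantile₁ (h : IsFullHalfLine ρ) (hi : Integrable (fun y => y) ρ) {α : ℝ}
    (h0 : 0 < α) (h1 : α < 1) :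
    HasDerivAt (fun α => ∫ s in (0 : ℝ)..α, quantile₁ ρ s) (quantile₁ ρ α) α :=
  intervalIntegral.integral_hasDerivAt_right
    (h.intervalIntegrable_quantile₁ hi (by simp) ⟨h0.le, h1.le⟩)
    h.measurable_quantile₁.stronglyMeasurable.stronglyMeasurableAtFilter
    (h.continuousAt_quantile₁ h0 h1)

lemma continuousOn_integral_quantile₁ (h : IsFullHalfLine ρ) (hi : Integrable (fun y => y) ρ) :
    ContinuousOn (fun α => ∫ s in (0 : ℝ)..α, quantile₁ ρ s) (Ico 0 1) := by
  have h1 := h.intervalIntegrable_quantile₁ hi (a := 0) (b := 1) (by simp) (by simp)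
  have := intervalIntegral.continuousOn_primitive_interval (a := 0) (b := 1)
    ((intervalIntegrable_iff' (by simp)).1 h1)
  rw [uIcc_of_le zero_le_one] at this
  exact this.mono Ico_subset_Icc_self

lemma monotoneOn_integral_quantile₁ (h : IsFullHalfLine ρ) (hi : Integrable (fun y => y) ρ) :
    MonotoneOn (fun α => ∫ s in (0 : ℝ)..α, quantile₁ ρ s) (Ico 0 1) := by
  refine monotoneOn_of_deriv_nonneg (convex_Ico 0 1) (h.continuousOn_integral_quantile₁ hi) ?_ ?_
  · rw [interior_Ico]
    exact fun α hα => (h.hasDerivAt_integral_quantile₁ hi hα.1 hα.2).differentiableAt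
      |>.differentiableWithinAt
  · rw [interior_Ico]
    intro α hα
    rw [(h.hasDerivAt_integral_quantile₁ hi hα.1 hα.2).deriv]
    exact h.quantile₁_nonneg α

lemma convexOn_integral_quantile₁ (h : IsFullHalfLine ρ) (hi : Integrable (fun y => y) ρ) :
    ConvexOn ℝ (Ico 0 1) (fun α => ∫ s in (0 : ℝ)..α, quantile₁ ρ s) := by
  refine MonotoneOn.convexOn_of_deriv (convex_Ico 0 1) (h.continuousOn_integral_quantile₁ hi) ?_ ?_
  · rw [interior_Ico]
    exact fun α hα => (h.hasDerivAt_integral_quantile₁ hi hα.1 hα.2).differentiableAt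
      |>.differentiableWithinAt
  · rw [interior_Ico]
    intro α hα β hβ hαβ
    rw [(h.hasDerivAt_integral_quantile₁ hi hα.1 hα.2).deriv,
      (h.hasDerivAt_integral_quantile₁ hi hβ.1 hβ.2).deriv]
    exact h.strictMonoOn_quantile₁.monotoneOn ⟨hα.1.le, hα.2⟩ ⟨hβ.1.le, hβ.2⟩ hαβ

end IsFullHalfLine

lemma convexOn_comp_pNorm {d : ℕ} {p : ℝ} (hp : 1 ≤ p) {D : Set ℝ} {h : ℝ → ℝ}
    (hc : ConvexOn ℝ D h) (hm : MonotoneOn h D) {s : Set (Vec d)} (hs : Convex ℝ s)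
    (hsD : MapsTo (pNorm p) s D) : ConvexOn ℝ s (fun x => h (pNorm p x)) := by
  refine ⟨hs, fun x hx y hy a b ha hb hab => ?_⟩
  have h1 := (convexOn_pNorm hp).2 (mem_univ x) (mem_univ y) ha hb hab
  exact (hm (hsD (hs hx hy ha hb hab)) (hc.1 (hsD hx) (hsD hy) ha hb hab) h1).trans
    (hc.2 (hsD hx) (hsD hy) ha hb hab)

end MK

/-! ### Polar decomposition of radial densities on the orthant -/

namespace MK

section Polar

open ENNReal Pointwise

variable {d : ℕ} {p : ℝ}

/-- The direction `x / ‖x‖_p`, with the value `0` at the origin. -/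
noncomputable def direction (p : ℝ) (x : Vec d) : Vec d := (pNorm p x)⁻¹ • x

lemma measurable_direction (hp : 0 < p) : Measurable (direction (d := d) p) := by
  have := measurable_pNorm (d := d) hp
  unfold direction
  fun_prop

lemma direction_smul (hp : 0 < p) {c : ℝ} (hc : 0 < c) (x : Vec d) :
    direction p (c • x) = direction p x := by
  rw [direction, direction, pNorm_smul hp, abs_of_pos hc, smul_smul, mul_inv, mul_assoc,
    mul_comm _ c, ← mul_assoc, inv_mul_cancel₀ hc.ne', one_mul]

lemma direction_mem_orthant (hp : 0 < p) {x : Vec d} :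
    direction p x ∈ orthant d ↔ x ∈ orthant d := by
  rcases eq_or_ne x 0 with rfl | hx
  · simp [direction]
  · exact smul_mem_orthant (inv_pos.2 (pNorm_pos hp hx))

lemma volume_pNorm_le_one_ne_top (hp : 0 < p) : volume {x : Vec d | pNorm p x ≤ 1} ≠ ∞ := by
  have h1 : {x : Vec d | pNorm p x ≤ 1} ⊆
      WithLp.ofLp ⁻¹' (Icc (fun _ => -1) (fun _ => 1) : Set (Fin d → ℝ)) := fun x hx =>
    have h (i : Fin d) := abs_le.1 ((abs_le_pNorm hp x i).trans hx)
    ⟨fun i => (h i).1, fun i => (h i).2⟩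
  refine ne_top_of_le_ne_top ?_ (measure_mono h1)
  rw [(PiLp.volume_preserving_ofLp (Fin d)).measure_preimage measurableSet_Icc.nullMeasurableSet]
  exact isCompact_Icc.measure_lt_top.ne

/-- The volume of the part of the unit ball of the orthant with directions in `S`. -/
noncomputable def sector (d : ℕ) (p : ℝ) (S : Set (Vec d)) : ℝ≥0∞ :=
  volume ({x : Vec d | pNorm p x ≤ 1} ∩ orthant d ∩ direction p ⁻¹' S)

lemma sector_ne_top (hp : 0 < p) (S : Set (Vec d)) : sector d p S ≠ ∞ :=
  ne_top_of_le_ne_top (volume_pNorm_le_one_ne_top hp)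
    (measure_mono (inter_subset_left.trans inter_subset_left))

/-- The law of the `p`-norm under the volume of the cone of directions `S` of the orthant. -/
noncomputable def radial (d : ℕ) (p : ℝ) (S : Set (Vec d)) : Measure ℝ :=
  (volume.restrict (orthant d ∩ direction p ⁻¹' S)).map (pNorm p)

/-- Homogeneity of the volume determines the radial part of a cone. -/
lemma radial_Iic (hd : 1 ≤ d) (hp : 0 < p) (S : Set (Vec d)) (r : ℝ) :
    radial d p S (Iic r) = ENNReal.ofReal r ^ d * sector d p S := by
  have hm := measurable_pNorm (d := d) hp
  rw [radial, Measure.map_apply hm measurableSet_Iic,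
    Measure.restrict_apply (hm measurableSet_Iic)]
  rcases le_or_gt r 0 with hr | hr
  · have h0 : pNorm p ⁻¹' Iic r ∩ (orthant d ∩ direction p ⁻¹' S) ⊆ {0} := by
      rintro x ⟨hx, -⟩
      by_contra hne
      exact absurd (pNorm_pos hp hne) (not_lt.2 (le_trans hx hr))
    have : Nonempty (Fin d) := ⟨⟨0, hd⟩⟩
    rw [measure_mono_null h0 (measure_singleton _), ENNReal.ofReal_of_nonpos hr,
      zero_pow (by omega), zero_mul]
  · have hset : pNorm p ⁻¹' Iic r ∩ (orthant d ∩ direction p ⁻¹' S) =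
        r • ({x : Vec d | pNorm p x ≤ 1} ∩ orthant d ∩ direction p ⁻¹' S) := by
      ext x
      rw [mem_smul_set_iff_inv_smul_mem₀ hr.ne']
      simp only [mem_inter_iff, mem_preimage, mem_Iic, mem_ofPred_eq,
        direction_smul hp (inv_pos.2 hr), smul_mem_orthant (inv_pos.2 hr), pNorm_smul hp,
        abs_of_pos (inv_pos.2 hr), inv_mul_le_iff₀ hr, mul_one, and_assoc]
    rw [hset, Measure.addHaar_smul, finrank_euclideanSpace_fin, abs_of_pos (by positivity),
      ENNReal.ofReal_pow hr.le, sector]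

lemma radial_Ioc (hd : 1 ≤ d) (hp : 0 < p) (S : Set (Vec d)) {a b : ℝ} (hab : a ≤ b) :
    radial d p S (Ioc a b) =
      (ENNReal.ofReal b ^ d - ENNReal.ofReal a ^ d) * sector d p S := by
  rw [← Iic_sdiff_Iic, measure_sdiff (Iic_subset_Iic.2 hab) measurableSet_Iic.nullMeasurableSet,
    radial_Iic hd hp, radial_Iic hd hp, ENNReal.sub_mul fun _ _ => sector_ne_top hp S]
  rw [radial_Iic hd hp]
  exact ENNReal.mul_ne_top (by simp) (sector_ne_top hp S)

/-- The radial parts of all cones are proportional. -/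
lemma sector_smul_radial (hd : 1 ≤ d) (hp : 0 < p) (S : Set (Vec d)) :
    sector d p univ • radial d p S = sector d p S • radial d p univ := by
  have : IsLocallyFiniteMeasure (sector d p univ • radial d p S) := by
    refine ⟨fun r => ⟨Iic (r + 1), Iic_mem_nhds (lt_add_one r), ?_⟩⟩
    rw [Measure.smul_apply, radial_Iic hd hp, smul_eq_mul]
    exact ENNReal.mul_lt_top (sector_ne_top hp _).lt_top
      (ENNReal.mul_lt_top (by simp) (sector_ne_top hp _).lt_top)
  refine Measure.ext_of_Ioc _ _ fun a b hab => ?_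
  rw [Measure.smul_apply, Measure.smul_apply, radial_Ioc hd hp _ hab.le, radial_Ioc hd hp _ hab.le,
    smul_eq_mul, smul_eq_mul]
  ring

lemma radial_singleton (hd : 1 ≤ d) (hp : 0 < p) (S : Set (Vec d)) (r : ℝ) :
    radial d p S {r} = 0 := by
  have h1 : ∀ a < r, radial d p S {r} ≤
      (ENNReal.ofReal r ^ d - ENNReal.ofReal a ^ d) * sector d p S := fun a ha => by
    rw [← radial_Ioc hd hp S ha.le]
    exact measure_mono (singleton_subset_iff.2 ⟨ha, le_rfl⟩)
  have h2 : Filter.Tendsto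
      (fun a => (ENNReal.ofReal r ^ d - ENNReal.ofReal a ^ d) * sector d p S)
      (nhdsWithin r (Iio r))
      (nhds ((ENNReal.ofReal r ^ d - ENNReal.ofReal r ^ d) * sector d p S)) := by
    refine ENNReal.Tendsto.mul_const (ENNReal.Tendsto.sub tendsto_const_nhds ?_
      (Or.inl (by simp))) (Or.inr (sector_ne_top hp S))
    have : Continuous fun a : ℝ => ENNReal.ofReal a ^ d :=
      (ENNReal.continuous_pow d).comp ENNReal.continuous_ofReal
    exact (this.tendsto r).mono_left nhdsWithin_le_nhds
  rw [tsub_self, zero_mul] at h2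
  exact le_antisymm (ge_of_tendsto h2 (Filter.eventually_of_mem self_mem_nhdsWithin h1)) zero_le

variable {g : ℝ → ℝ≥0∞} {ν : Measure (Vec d)}

lemma radialDensity_apply (hp : 0 < p) (hg : Measurable g)
    (hν : ν = (volume.restrict (orthant d)).withDensity fun x => g (pNorm p x))
    {A : Set ℝ} {S : Set (Vec d)} (hA : MeasurableSet A) (hS : MeasurableSet S) :
    ν (pNorm p ⁻¹' A ∩ direction p ⁻¹' S) = ∫⁻ r in A, g r ∂radial d p S := by
  have hm := measurable_pNorm (d := d) hp
  have hD := measurable_direction (d := d) hp hS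
  rw [hν, withDensity_apply _ ((hm hA).inter hD), radial, setLIntegral_map hA hg hm,
    Measure.restrict_restrict ((hm hA).inter hD), Measure.restrict_restrict (hm hA)]
  congr 2
  ext x
  simp only [mem_inter_iff]
  tauto

lemma sector_univ_ne_zero (hd : 1 ≤ d) (hp : 0 < p) [IsProbabilityMeasure ν] (hg : Measurable g)
    (hν : ν = (volume.restrict (orthant d)).withDensity fun x => g (pNorm p x)) :
    sector d p univ ≠ 0 := by
  intro h
  have h1 : radial d p univ = 0 := by
    refine Measure.measure_univ_eq_zero.1 ?_
    have : (univ : Set ℝ) = ⋃ n : ℕ, Iic (n : ℝ) :=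
      (eq_univ_of_forall fun r => mem_iUnion.2 (exists_nat_ge r)).symm
    rw [this]
    exact measure_iUnion_null fun n => by rw [radial_Iic hd hp, h, mul_zero]
  have h2 := radialDensity_apply hp hg hν MeasurableSet.univ MeasurableSet.univ
  rw [h1] at h2
  simp at h2

/-- Under a law with a radial density on the orthant, the norm and the direction are independent,
and the direction has the cone measure. -/
lemma map_pNorm_direction (hd : 1 ≤ d) (hp : 0 < p) [IsProbabilityMeasure ν] (hg : Measurable g)
    (hν : ν = (volume.restrict (orthant d)).withDensity fun x => g (pNorm p x)) :
    ν.map (fun x => (pNorm p x, direction p x)) =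
      (ν.map (pNorm p)).prod
        ((cond volume ({x : Vec d | pNorm p x ≤ 1} ∩ orthant d)).map (direction p)) := by
  have hm := measurable_pNorm (d := d) hp
  have hD := measurable_direction (d := d) hp
  have hB : MeasurableSet ({x : Vec d | pNorm p x ≤ 1} ∩ orthant d) :=
    (hm measurableSet_Iic).inter measurableSet_orthant
  have h0 := sector_univ_ne_zero hd hp hg hν
  have htop := sector_ne_top (d := d) hp univ
  have hsec : volume ({x : Vec d | pNorm p x ≤ 1} ∩ orthant d) = sector d p univ := by
    rw [sector, preimage_univ, inter_univ]
  have : IsProbabilityMeasure (ν.map (pNorm p)) :=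
    Measure.isProbabilityMeasure_map hm.aemeasurable
  have : IsProbabilityMeasure (cond volume ({x : Vec d | pNorm p x ≤ 1} ∩ orthant d)) :=
    cond_isProbabilityMeasure_of_finite (by rwa [hsec]) (by rwa [hsec])
  have : IsProbabilityMeasure
      ((cond volume ({x : Vec d | pNorm p x ≤ 1} ∩ orthant d)).map (direction p)) :=
    Measure.isProbabilityMeasure_map hD.aemeasurable
  refine (Measure.prod_eq fun A S hA hS => ?_).symm
  rw [Measure.map_apply (hm.prodMk hD) (hA.prod hS), Measure.map_apply hm hA,
    Measure.map_apply hD hS, cond_apply hB, mk_preimage_prod,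
    hsec, ← sector]
  have h1 := radialDensity_apply hp hg hν hA hS
  have h2 := radialDensity_apply hp hg hν hA MeasurableSet.univ
  rw [preimage_univ, inter_univ] at h2
  have h3 : sector d p univ * ∫⁻ r in A, g r ∂radial d p S =
      sector d p S * ∫⁻ r in A, g r ∂radial d p univ := by
    rw [← smul_eq_mul, ← smul_eq_mul, ← lintegral_smul_measure, ← lintegral_smul_measure,
      ← Measure.restrict_smul, ← Measure.restrict_smul, sector_smul_radial hd hp]
  rw [h1, h2, ← ENNReal.mul_right_inj h0 htop, h3, mul_left_comm, ← mul_assoc (sector d p univ),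
    ENNReal.mul_inv_cancel h0 htop, one_mul, mul_comm]

/-- Under a law with a positive radial density on the orthant, the norm has a full atomless law. -/
lemma isFullHalfLine_map_pNorm (hd : 1 ≤ d) (hp : 0 < p) [IsProbabilityMeasure ν]
    (hg : Measurable g) (hg0 : ∀ r, g r ≠ 0)
    (hν : ν = (volume.restrict (orthant d)).withDensity fun x => g (pNorm p x)) :
    IsFullHalfLine (ν.map (pNorm p)) := by
  have hm := measurable_pNorm (d := d) hp
  have happ : ∀ A, MeasurableSet A → ν.map (pNorm p) A = ∫⁻ r in A, g r ∂radial d p univ := by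
    intro A hA
    rw [Measure.map_apply hm hA, ← radialDensity_apply hp hg hν hA MeasurableSet.univ, preimage_univ,
      inter_univ]
  refine ⟨Measure.isProbabilityMeasure_map hm.aemeasurable, ⟨fun r => ?_⟩, ?_, fun a b ha hab => ?_⟩
  · rw [happ _ (measurableSet_singleton r),
      Measure.restrict_eq_zero.2 (radial_singleton hd hp univ r), lintegral_zero_measure]
  · rw [happ _ measurableSet_Iic, Measure.restrict_eq_zero.2, lintegral_zero_measure]
    rw [radial_Iic hd hp, ENNReal.ofReal_zero, zero_pow (by omega), zero_mul]
  · have hsupp : Function.support g = univ := eq_univ_of_forall hg0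
    rw [happ _ measurableSet_Ioc, setLIntegral_pos_iff hg, hsupp, univ_inter,
      radial_Ioc hd hp _ hab.le]
    refine ENNReal.mul_pos ?_ (sector_univ_ne_zero hd hp hg hν)
    rw [Ne, tsub_eq_zero_iff_le, not_le]
    exact ENNReal.pow_lt_pow_left (by omega) ((ENNReal.ofReal_lt_ofReal_iff_of_nonneg ha).2 hab)

end Polar

/-! ### The reference distribution -/

section Reference

variable {d : ℕ} {p q : ℝ}

lemma cond_map {α β : Type*} [MeasurableSpace α] [MeasurableSpace β] {κ : Measure α} {f : α → β}
    (hf : Measurable f) {s : Set β} (hs : MeasurableSet s) :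
    cond (κ.map f) s = (cond κ (f ⁻¹' s)).map f := by
  rw [ProbabilityTheory.cond, ProbabilityTheory.cond, Measure.map_smul, Measure.restrict_map hf hs, Measure.map_apply hf hs]

/-- Restricting the reference distribution to the orthant amounts to restricting its directions. -/
lemma conjSphericalPos_eq (hp : 1 < p) (hq : q = p / (p - 1))
    (h0 : volume ({x : Vec d | pNorm p x ≤ 1} ∩ orthant d) ≠ 0) :
    conjSphericalPos d q = ((volume.restrict (Icc (0 : ℝ) 1)).prod
      (((cond volume ({x : Vec d | pNorm p x ≤ 1} ∩ orthant d)).map (direction p)).map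
        (compPow (p - 1)))).map fun z => z.1 • z.2 := by
  have hp0 : 0 < p := by linarith
  have htop := volume_pNorm_le_one_ne_top (d := d) hp0
  have hpq : q / (q - 1) = p := by
    have h1 : p - 1 ≠ 0 := by linarith
    have h2 : q - 1 = 1 / (p - 1) := by rw [hq]; field_simp; ring
    rw [h2, hq]; field_simp
  have hB : MeasurableSet {x : Vec d | pNorm p x ≤ 1} := measurable_pNorm hp0 measurableSet_Iic
  have hO := measurableSet_orthant (d := d)
  have hD := measurable_direction (d := d) hp0
  have hc := measurable_compPow (d := d) (p - 1)
  have hsm : Measurable fun z : ℝ × Vec d => z.1 • z.2 := by fun_prop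
  have hB0 : volume {x : Vec d | pNorm p x ≤ 1} ≠ 0 := fun h =>
    h0 (measure_mono_null inter_subset_left h)
  have : IsProbabilityMeasure (cond volume {x : Vec d | pNorm p x ≤ 1}) :=
    cond_isProbabilityMeasure_of_finite hB0 htop
  rw [conjSphericalPos, conjSpherical, hpq, cond_map hsm hO, uniformSphere]
  congr 1
  change ProbabilityTheory.cond (Measure.prod _ ((Measure.map (direction p) _).map _)) _ = _
  set Φ := ((cond volume {x : Vec d | pNorm p x ≤ 1}).map (direction p)).map (compPow (p - 1))
    with hΦ
  have : IsProbabilityMeasure ((cond volume {x : Vec d | pNorm p x ≤ 1}).map (direction p)) :=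
    Measure.isProbabilityMeasure_map hD.aemeasurable
  have : IsProbabilityMeasure Φ := Measure.isProbabilityMeasure_map hc.aemeasurable
  have hcondΦ : cond Φ (orthant d) =
      ((cond volume ({x : Vec d | pNorm p x ≤ 1} ∩ orthant d)).map (direction p)).map
        (compPow (p - 1)) := by
    rw [hΦ, cond_map hc hO, cond_map hD (hc hO)]
    have : direction p ⁻¹' (compPow (p - 1) ⁻¹' orthant d) = orthant d := by
      ext x
      exact compPow_mem_orthant.trans (direction_mem_orthant hp0)
    rw [this, cond_cond_eq_cond_inter' hB hO htop]
  rw [← hcondΦ]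
  -- the radius vanishes with probability `0`, so that only the direction matters
  have hset : ((fun z : ℝ × Vec d => z.1 • z.2) ⁻¹' orthant d : Set (ℝ × Vec d))
      =ᵐ[(volume.restrict (Icc (0 : ℝ) 1)).prod Φ] (univ ×ˢ orthant d : Set (ℝ × Vec d)) := by
    have hpos : ∀ᵐ r ∂(volume.restrict (Icc (0 : ℝ) 1)), 0 < r := by
      have h1 : ∀ᵐ r : ℝ, r ≠ 0 := by rw [ae_iff]; simp
      filter_upwards [ae_restrict_of_ae h1, ae_restrict_mem measurableSet_Icc] with r h2 h3
      exact h3.1.lt_of_ne' h2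
    filter_upwards [Measure.quasiMeasurePreserving_fst.ae hpos] with z hz
    refine propext (?_ : z.1 • z.2 ∈ orthant d ↔ z ∈ (univ ×ˢ orthant d : Set (ℝ × Vec d)))
    rw [smul_mem_orthant hz]
    simp
  rw [ProbabilityTheory.cond, ProbabilityTheory.cond, Measure.restrict_congr_set hset, measure_congr hset, Measure.prod_prod,
    ← Measure.prod_restrict, Measure.restrict_univ, Measure.prod_smul_right]
  simp

end Reference

end MK

/-! ### Radial maps between conjugate norms -/

namespace MK

section RadialMap

variable {d : ℕ} {p q : ℝ}

/-- The map `x ↦ g(‖x‖_p) (x / ‖x‖_p)^{⊗(p-1)}`, which is the gradient of `x ↦ ∫₀^{‖x‖_p} g`. -/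
noncomputable def radialMap (p : ℝ) (g : ℝ → ℝ) (x : Vec d) : Vec d :=
  g (pNorm p x) • compPow (p - 1) ((pNorm p x)⁻¹ • x)

lemma compPow_zero (a : ℝ) : compPow a (0 : Vec d) = 0 := by
  ext i
  simp [compPow_apply]

lemma measurable_radialMap (hp : 0 < p) {g : ℝ → ℝ} (hg : Measurable g) :
    Measurable (radialMap (d := d) p g) :=
  (hg.comp (measurable_pNorm hp)).smul ((measurable_compPow _).comp (measurable_direction hp))

lemma pNorm_smul_compPow (hpq : p.HolderConjugate q) {x : Vec d} (hx : x ≠ 0)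
    {c : ℝ} (hc : 0 ≤ c) : pNorm q (c • compPow (p - 1) ((pNorm p x)⁻¹ • x)) = c := by
  rw [pNorm_smul hpq.symm.pos, pNorm_compPow hpq.sub_one_pos hpq.sub_one_mul_conj
    (pNorm_inv_smul hpq.pos hx) hpq.pos, mul_one, abs_of_nonneg hc]

lemma pNorm_radialMap (hpq : p.HolderConjugate q) {g : ℝ → ℝ} {x : Vec d} (hx : x ≠ 0)
    (hg : 0 < g (pNorm p x)) : pNorm q (radialMap p g x) = g (pNorm p x) :=
  pNorm_smul_compPow hpq hx hg.le

lemma direction_radialMap (hpq : p.HolderConjugate q) {g : ℝ → ℝ} {x : Vec d} (hx : x ≠ 0)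
    (hg : 0 < g (pNorm p x)) :
    (pNorm q (radialMap p g x))⁻¹ • radialMap p g x = compPow (p - 1) ((pNorm p x)⁻¹ • x) := by
  rw [pNorm_radialMap hpq hx hg, radialMap, smul_smul, inv_mul_cancel₀ hg.ne', one_smul]

lemma radialMap_radialMap (hpq : p.HolderConjugate q) {g h : ℝ → ℝ} {x : Vec d} (hx : x ≠ 0)
    (hg : 0 < g (pNorm p x)) (hgh : h (g (pNorm p x)) = pNorm p x) :
    radialMap q h (radialMap p g x) = x := by
  have h1 : (p - 1) * (q - 1) = 1 := by
    have := hpq.sub_one_mul_conj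
    linarith
  rw [radialMap, direction_radialMap hpq hx hg, pNorm_radialMap hpq hx hg, hgh,
    compPow_compPow hpq.sub_one_pos h1, smul_smul,
    mul_inv_cancel₀ (pNorm_pos hpq.pos hx).ne', one_smul]

lemma radialMap_mem_orthant (hp : 0 < p) {g : ℝ → ℝ} {x : Vec d} (hx : x ≠ 0)
    (hg : 0 < g (pNorm p x)) : radialMap p g x ∈ orthant d ↔ x ∈ orthant d :=
  (smul_mem_orthant hg).trans <| compPow_mem_orthant.trans <|
    smul_mem_orthant (inv_pos.2 (pNorm_pos hp hx))

/-- Along a ray, a radial map has a constant direction. -/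
lemma radialMap_smul_direction (hp : 0 < p) {g : ℝ → ℝ} (hg : g 0 = 0) {x : Vec d} (hx : x ≠ 0)
    {t : ℝ} (ht : 0 ≤ t) :
    radialMap p g (t • (pNorm p x)⁻¹ • x) = g t • compPow (p - 1) ((pNorm p x)⁻¹ • x) := by
  rcases ht.eq_or_lt with rfl | ht
  · simp [radialMap, compPow_zero, hg]
  · have h1 : pNorm p (t • (pNorm p x)⁻¹ • x) = t := by
      rw [pNorm_smul hp, pNorm_inv_smul hp hx, mul_one, abs_of_pos ht]
    rw [radialMap, h1, smul_smul t⁻¹, inv_mul_cancel₀ ht.ne', one_smul]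

end RadialMap

/-! ### The law of a vector with independent generalized gamma components -/

section Law

variable {d : ℕ} {p : ℝ}

lemma pi_withDensity_ofReal {f : ℝ → ℝ} (hf0 : ∀ x, 0 ≤ f x)
    (hfi : Integrable f) :
    Measure.pi (fun _ : Fin d => volume.withDensity fun x => ENNReal.ofReal (f x)) =
      volume.withDensity fun x : Fin d → ℝ => ENNReal.ofReal (∏ i, f (x i)) := by
  have : IsFiniteMeasure (volume.withDensity fun x => ENNReal.ofReal (f x)) :=
    isFiniteMeasure_withDensity_ofReal hfi.2
  refine Measure.pi_eq fun s hs => ?_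
  have h1 : ∀ i, Integrable ((s i).indicator f) := fun i => hfi.indicator (hs i)
  have h2 : ∀ x : Fin d → ℝ, (univ.pi s).indicator (fun x => ENNReal.ofReal (∏ i, f (x i))) x =
      ENNReal.ofReal (∏ i, (s i).indicator f (x i)) := by
    intro x
    by_cases hx : x ∈ univ.pi s
    · rw [indicator_of_mem hx]
      congr 1
      exact Finset.prod_congr rfl fun i _ => (indicator_of_mem (hx i (mem_univ i)) f).symm
    · rw [indicator_of_notMem hx]
      simp only [mem_pi, mem_univ, true_implies, not_forall] at hx
      obtain ⟨i, hi⟩ := hx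
      rw [Finset.prod_eq_zero (Finset.mem_univ i) (indicator_of_notMem hi f), ENNReal.ofReal_zero]
  have h3 : ∀ i x, 0 ≤ (s i).indicator f x := fun i x => indicator_nonneg (fun x _ => hf0 x) x
  rw [withDensity_apply _ (MeasurableSet.univ_pi hs), ← lintegral_indicator
    (MeasurableSet.univ_pi hs)]
  simp_rw [h2]
  rw [volume_pi, ← ofReal_integral_eq_lintegral_ofReal (Integrable.fintype_prod h1)
    (ae_of_all _ fun x => Finset.prod_nonneg fun i _ => h3 i _),
    integral_fintype_prod_eq_prod (f := fun i => (s i).indicator f),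
    ENNReal.ofReal_prod_of_nonneg fun i _ => integral_nonneg (h3 i)]
  refine Finset.prod_congr rfl fun i _ => ?_
  rw [ofReal_integral_eq_lintegral_ofReal (h1 i) (ae_of_all _ (h3 i)), withDensity_apply _ (hs i),
    ← lintegral_indicator (hs i)]
  congr 1
  ext x
  by_cases hx : x ∈ s i <;> simp [hx]

lemma genGamma_const_pos (hp : 1 < p) : 0 < p / Real.Gamma p⁻¹ :=
  div_pos (by linarith) (Real.Gamma_pos_of_pos (inv_pos.2 (by linarith)))

/-- The real density of the law `L_p`. -/
noncomputable def genGammaPDF (p : ℝ) : ℝ → ℝ :=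
  (Ici (0 : ℝ)).indicator fun x => p / Real.Gamma p⁻¹ * Real.exp (-x ^ p)

lemma measurable_genGammaPDF (p : ℝ) : Measurable (genGammaPDF p) :=
  Measurable.indicator (by fun_prop) measurableSet_Ici

lemma genGammaPDF_nonneg (hp : 1 < p) (x : ℝ) : 0 ≤ genGammaPDF p x :=
  indicator_nonneg (fun _ _ => mul_nonneg (genGamma_const_pos hp).le (Real.exp_pos _).le) x

lemma integrable_rpow_mul_genGammaPDF (hp : 1 < p) {s : ℝ} (hs : -1 < s) :
    Integrable fun x => x ^ s * genGammaPDF p x := by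
  have h1 := (integrableOn_rpow_mul_exp_neg_rpow hs (by linarith : 0 < p)).const_mul
    (p / Real.Gamma p⁻¹)
  rw [← IntegrableOn, ← integrableOn_Ici_iff_integrableOn_Ioi,
    ← integrable_indicator_iff measurableSet_Ici] at h1
  refine h1.congr (ae_of_all _ fun x => ?_)
  by_cases hx : x ∈ Ici (0 : ℝ)
  · simp only [genGammaPDF, indicator_of_mem hx]; ring
  · simp only [genGammaPDF, indicator_of_notMem hx]; ring

lemma integrable_genGammaPDF (hp : 1 < p) : Integrable (genGammaPDF p) := by
  simpa using integrable_rpow_mul_genGammaPDF hp (s := 0) (by norm_num)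

/-- The law `L_p` has a finite mean. -/
lemma integrable_id_genGammaLaw (hp : 1 < p) : Integrable (fun x => x) (genGammaLaw p) := by
  change Integrable (fun x => x) (volume.withDensity fun x => ENNReal.ofReal (genGammaPDF p x))
  rw [integrable_withDensity_iff (measurable_genGammaPDF p).ennreal_ofReal
    (ae_of_all _ fun x => ENNReal.ofReal_lt_top)]
  simp_rw [ENNReal.toReal_ofReal (genGammaPDF_nonneg hp _)]
  simpa using integrable_rpow_mul_genGammaPDF hp (s := 1) (by norm_num)

variable {Ω : Type*} [MeasurableSpace Ω] {P : Measure Ω} {X : Ω → Vec d}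

lemma aemeasurable_of_hasLaw {κ : Measure ℝ} (hlaw : ∀ i, HasLaw (fun ω => X ω i) κ P) :
    AEMeasurable X P :=
  (MeasurableEquiv.toLp 2 (Fin d → ℝ)).measurable.comp_aemeasurable
    (aemeasurable_pi_lambda (fun ω i => X ω i) fun i => (hlaw i).aemeasurable)

/-- The density of the vector is a radial function on the orthant. -/
lemma map_eq_withDensity_pNorm (hp : 1 < p) [IsProbabilityMeasure P]
    (hind : iIndepFun (fun (i : Fin d) (ω : Ω) => X ω i) P)
    (hlaw : ∀ i, HasLaw (fun ω => X ω i) (genGammaLaw p) P) :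
    P.map X = (volume.restrict (orthant d)).withDensity fun x =>
      ENNReal.ofReal ((p / Real.Gamma p⁻¹) ^ d * Real.exp (-pNorm p x ^ p)) := by
  have h1 := (iIndepFun_iff_map_fun_eq_pi_map fun i => (hlaw i).aemeasurable).1 hind
  simp_rw [fun i => (hlaw i).map_eq] at h1
  have h2 : Measure.pi (fun _ : Fin d => genGammaLaw p) = _ :=
    pi_withDensity_ofReal (genGammaPDF_nonneg hp)
      (integrable_genGammaPDF hp)
  have hme : Measurable (WithLp.toLp 2 : (Fin d → ℝ) → Vec d) :=
    (MeasurableEquiv.toLp 2 (Fin d → ℝ)).measurable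
  have h3 : P.map X = (P.map fun ω i => X ω i).map (WithLp.toLp 2) := by
    rw [AEMeasurable.map_map_of_aemeasurable hme.aemeasurable
      (aemeasurable_pi_lambda (fun ω i => X ω i) fun i => (hlaw i).aemeasurable)]
    rfl
  have h4 : ∀ x : Vec d, ENNReal.ofReal (∏ i, genGammaPDF p (x i)) =
      (orthant d).indicator (fun x : Vec d =>
        ENNReal.ofReal ((p / Real.Gamma p⁻¹) ^ d * Real.exp (-pNorm p x ^ p))) x := by
    intro x
    by_cases hx : x ∈ orthant d
    · rw [indicator_of_mem hx]
      congr 1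
      have h5 : ∀ i, genGammaPDF p (x i) = p / Real.Gamma p⁻¹ * Real.exp (-|x i| ^ p) := fun i => by
        rw [genGammaPDF, indicator_of_mem (mem_Ici.2 (hx i)), abs_of_nonneg (hx i)]
      simp_rw [h5]
      rw [Finset.prod_mul_distrib, ← Real.exp_sum, Finset.sum_neg_distrib,
        pNorm_rpow (by linarith), Finset.prod_const, Finset.card_univ, Fintype.card_fin]
    · rw [indicator_of_notMem hx]
      simp only [orthant, mem_ofPred_eq, not_forall] at hx
      obtain ⟨i, hi⟩ := hx
      rw [Finset.prod_eq_zero (Finset.mem_univ i), ENNReal.ofReal_zero]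
      exact indicator_of_notMem (s := Ici (0 : ℝ)) hi _
  have h5 : Measurable fun x : Vec d => ENNReal.ofReal (∏ i, genGammaPDF p (x i)) := by
    have := measurable_genGammaPDF p
    fun_prop
  rw [← withDensity_indicator measurableSet_orthant, ← funext h4, h3, h1, h2]
  ext A hA
  rw [Measure.map_apply hme hA, withDensity_apply _ (hme hA), withDensity_apply _ hA,
    ← (PiLp.volume_preserving_toLp (Fin d)).setLIntegral_comp_preimage hA h5]
  rfl

end Law

end MK

/-! ### Transport between the law and the reference distribution -/

namespace MK

section Transport

variable {d : ℕ} {p q : ℝ}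

lemma norm_le_sum_abs (x : Vec d) : ‖x‖ ≤ ∑ i, |x i| := by
  refine (le_of_eq ?_).trans (pNorm_le_sum one_le_two x)
  rw [EuclideanSpace.norm_eq, pNorm, Real.sqrt_eq_rpow]
  simp

lemma norm_le_mul_pNorm (hp : 0 < p) (x : Vec d) : ‖x‖ ≤ d * pNorm p x := by
  refine (norm_le_sum_abs x).trans ((Finset.sum_le_sum fun i _ => abs_le_pNorm hp x i).trans ?_)
  simp

lemma convex_pNorm_lt (hp : 1 ≤ p) (r : ℝ) : Convex ℝ {x : Vec d | pNorm p x < r} := by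
  simpa using (convexOn_pNorm (d := d) hp).convex_lt r

/-- Uniqueness of a gradient of a convex function from an integrable law to a bounded one. -/
lemma IsMKQuantile.ae_eq_of_bounded_target {μ ν : Measure (Vec d)} [IsProbabilityMeasure μ]
    {T T' : Vec d → Vec d} (hT : IsMKQuantile μ ν T) (hT' : IsMKQuantile μ ν T')
    (hμ : Integrable (fun x => ‖x‖) μ) {M : ℝ} (hν : ∀ᵐ y ∂ν, ‖y‖ ≤ M) : T' =ᵐ[μ] T := by
  have hprob : IsProbabilityMeasure ν := hT.map_eq ▸ Measure.isProbabilityMeasure_map hT.aemeasurable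
  have key : ∀ S, IsMKQuantile μ ν S → Integrable (fun x => inner ℝ x (S x)) μ := by
    intro S hS
    refine (hμ.mul_const M).mono' (aestronglyMeasurable_id.inner
      hS.aemeasurable.aestronglyMeasurable) ?_
    filter_upwards [ae_of_ae_map hS.aemeasurable (hS.map_eq ▸ hν)] with x hx
    exact (norm_inner_le_norm _ _).trans (mul_le_mul_of_nonneg_left hx (norm_nonneg _))
  exact hT.ae_eq hT' hμ (Integrable.of_bound (by fun_prop) M (by simpa using hν)) (key T hT)
    (key T' hT')

/-- Uniqueness of a gradient of a convex function from a bounded law to an integrable one. -/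
lemma IsMKQuantile.ae_eq_of_bounded_source {μ ν : Measure (Vec d)} [IsProbabilityMeasure μ]
    {T T' : Vec d → Vec d} (hT : IsMKQuantile μ ν T) (hT' : IsMKQuantile μ ν T')
    {M : ℝ} (hμ : ∀ᵐ x ∂μ, ‖x‖ ≤ M) (hν : Integrable (fun y => ‖y‖) ν) : T' =ᵐ[μ] T := by
  have key : ∀ S, IsMKQuantile μ ν S → Integrable (fun x => inner ℝ x (S x)) μ := by
    intro S hS
    have hi : Integrable (fun x => ‖S x‖) μ := by
      rw [← hS.map_eq] at hν
      exact hν.comp_aemeasurable hS.aemeasurable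
    refine (hi.const_mul M).mono' (aestronglyMeasurable_id.inner
      hS.aemeasurable.aestronglyMeasurable) ?_
    filter_upwards [hμ] with x hx
    exact (norm_inner_le_norm _ _).trans (mul_le_mul_of_nonneg_right hx (norm_nonneg _))
  exact hT.ae_eq hT' (Integrable.of_bound (by fun_prop) M (by simpa using hμ)) hν (key T hT)
    (key T' hT')

variable {g : ℝ → ENNReal} {ν : Measure (Vec d)} [IsProbabilityMeasure ν]

lemma ae_mem_orthant_and_pNorm_pos (hd : 1 ≤ d) (hp : 0 < p)
    (hg : Measurable g) (hg0 : ∀ r, g r ≠ 0)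
    (hν : ν = (volume.restrict (orthant d)).withDensity fun x => g (pNorm p x)) :
    ∀ᵐ x ∂ν, x ∈ orthant d ∧ 0 < pNorm p x := by
  have h1 := (isFullHalfLine_map_pNorm hd hp hg hg0 hν).ae_pos
  have h2 : ∀ᵐ x ∂ν, x ∈ orthant d := by
    have : ν ≪ volume.restrict (orthant d) := hν ▸ withDensity_absolutelyContinuous _ _
    exact this.ae_le (ae_restrict_mem measurableSet_orthant)
  filter_upwards [h2, ae_of_ae_map (measurable_pNorm hp).aemeasurable h1] with x h3 h4
  exact ⟨h3, h4⟩

lemma conjSphericalPos_eq_of_density (hd : 1 ≤ d) (hp : 1 < p) (hq : q = p / (p - 1))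
    (hg : Measurable g)
    (hν : ν = (volume.restrict (orthant d)).withDensity fun x => g (pNorm p x)) :
    conjSphericalPos d q = ((volume.restrict (Icc (0 : ℝ) 1)).prod
      (((cond volume ({x : Vec d | pNorm p x ≤ 1} ∩ orthant d)).map (direction p)).map
        (compPow (p - 1)))).map fun z => z.1 • z.2 := by
  have hp0 : 0 < p := by linarith
  refine conjSphericalPos_eq hp hq ?_
  have := sector_univ_ne_zero hd hp0 hg hν
  rwa [sector, preimage_univ, inter_univ] at this

/-- The radial map built from the distribution function of the norm is a transport map to the
reference distribution. -/
lemma map_radialMap_cdf (hd : 1 ≤ d) (hp : 1 < p) (hq : q = p / (p - 1))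
    (hg : Measurable g) (hg0 : ∀ r, g r ≠ 0)
    (hν : ν = (volume.restrict (orthant d)).withDensity fun x => g (pNorm p x)) :
    ν.map (radialMap p (cdf (ν.map (pNorm p)))) = conjSphericalPos d q := by
  have hp0 : 0 < p := by linarith
  have hm := measurable_pNorm (d := d) hp0
  have hD := measurable_direction (d := d) hp0
  have hc := measurable_compPow (d := d) (p - 1)
  have hG : Measurable (cdf (ν.map (pNorm p))) := (monotone_cdf _).measurable
  have hsm : Measurable fun z : ℝ × Vec d => z.1 • z.2 := by fun_prop
  rw [conjSphericalPos_eq_of_density hd hp hq hg hν,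
    ← (isFullHalfLine_map_pNorm hd hp0 hg hg0 hν).map_cdf, Measure.map_prod_map _ _ hG hc,
    ← map_pNorm_direction hd hp0 hg hν, Measure.map_map (hG.prodMap hc) (hm.prodMk hD),
    Measure.map_map hsm ((hG.prodMap hc).comp (hm.prodMk hD))]
  rfl

/-- A null set of the reference distribution is null along almost every ray. -/
lemma ae_ray (hd : 1 ≤ d) (hp : 1 < p) (hq : q = p / (p - 1)) (hpq : p.HolderConjugate q)
    (hg : Measurable g) (hg0 : ∀ r, g r ≠ 0)
    (hν : ν = (volume.restrict (orthant d)).withDensity fun x => g (pNorm p x))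
    {R : Vec d → Prop} (hR : ∀ᵐ u ∂conjSphericalPos d q, R u) :
    ∀ᵐ u ∂conjSphericalPos d q, ∀ᵐ t ∂volume.restrict (Icc (0 : ℝ) 1),
      R (t • (pNorm q u)⁻¹ • u) := by
  have hp0 : 0 < p := by linarith
  have hm := measurable_pNorm (d := d) hp0
  have hD := measurable_direction (d := d) hp0
  have hc := measurable_compPow (d := d) (p - 1)
  have hsm : Measurable fun z : ℝ × Vec d => z.1 • z.2 := by fun_prop
  set U : Measure ℝ := volume.restrict (Icc (0 : ℝ) 1)
  obtain ⟨N, hN, hNm, hN0⟩ := exists_measurable_superset_of_null (ae_iff.1 hR)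
  suffices h : ∀ᵐ u ∂conjSphericalPos d q, U {t | t • (pNorm q u)⁻¹ • u ∈ N} = 0 by
    filter_upwards [h] with u hu
    rw [ae_iff]
    exact measure_mono_null (fun t ht => hN ht) hu
  -- the set of good directions is measurable, so that it may be tested on images
  have hmeas : ∀ f : Vec d → Vec d, Measurable f →
      MeasurableSet {u | U {t | t • f u ∈ N} = 0} := by
    intro f hf
    have h1 : MeasurableSet {z : Vec d × ℝ | z.2 • f z.1 ∈ N} :=
      (by fun_prop : Measurable fun z : Vec d × ℝ => z.2 • f z.1) hNm
    exact (measurable_measure_prodMk_left (ν := U) h1) (measurableSet_singleton 0)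
  have h1 : ∀ᵐ φ ∂((cond volume ({x : Vec d | pNorm p x ≤ 1} ∩ orthant d)).map
      (direction p)).map (compPow (p - 1)), U {t | t • φ ∈ N} = 0 := by
    rw [conjSphericalPos_eq_of_density hd hp hq hg hν, Measure.map_apply hsm hNm,
      ← Measure.prod_swap, Measure.map_apply measurable_swap (hsm hNm)] at hN0
    exact Measure.measure_ae_null_of_prod_null hN0
  have h2 : ∀ᵐ x ∂ν, U {t | t • compPow (p - 1) (direction p x) ∈ N} = 0 := by
    have h3 := ae_of_ae_map hc.aemeasurable h1
    have h4 := (Measure.quasiMeasurePreserving_snd (μ := ν.map (pNorm p))).ae h3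
    rw [← map_pNorm_direction hd hp0 hg hν] at h4
    exact ae_of_ae_map (hm.prodMk hD).aemeasurable h4
  have hfull := isFullHalfLine_map_pNorm hd hp0 hg hg0 hν
  have hF : Measurable (radialMap (d := d) p (cdf (ν.map (pNorm p)))) :=
    measurable_radialMap hp0 (monotone_cdf _).measurable
  rw [← map_radialMap_cdf hd hp hq hg hg0 hν, ae_map_iff hF.aemeasurable
    (hmeas (fun u => (pNorm q u)⁻¹ • u) (measurable_direction hpq.symm.pos))]
  filter_upwards [h2, ae_mem_orthant_and_pNorm_pos hd hp0 hg hg0 hν] with x h3 h4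
  rw [direction_radialMap hpq (ne_zero_of_pNorm_pos hp0 h4.2) (hfull.cdf_pos h4.2)]
  exact h3

end Transport

end MK

/-! ### Superquantiles and expected shortfalls -/

namespace MK

section Shortfall

variable {d : ℕ} {q : ℝ} {ρ : Measure ℝ}

lemma intervalIntegrable_radialMap (hq : 0 < q) (h : IsFullHalfLine ρ)
    (hi : Integrable (fun y => y) ρ) {u : Vec d} (hu : u ≠ 0) :
    IntervalIntegrable (fun t : ℝ => radialMap q (quantile₁ ρ) (t • (pNorm q u)⁻¹ • u))
      volume 0 1 := by
  have h1 : IntervalIntegrable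
      (fun t : ℝ => quantile₁ ρ t • compPow (q - 1) ((pNorm q u)⁻¹ • u)) volume 0 1 :=
    have h2 := h.intervalIntegrable_quantile₁ hi (a := 0) (b := 1) (by simp) (by simp)
    ⟨h2.1.smul_const _, h2.2.smul_const _⟩
  refine h1.congr fun t ht => ?_
  rw [uIoc_of_le zero_le_one] at ht
  exact (radialMap_smul_direction hq (quantile₁_of_nonpos ρ le_rfl) hu ht.1.le).symm

lemma intervalIntegral_radialMap (hq : 0 < q) {u : Vec d} (hu : u ≠ 0)
    {a b : ℝ} (ha : 0 ≤ a) (hab : a ≤ b) :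
    ∫ t in a..b, radialMap q (quantile₁ ρ) (t • (pNorm q u)⁻¹ • u) =
      (∫ t in a..b, quantile₁ ρ t) • compPow (q - 1) ((pNorm q u)⁻¹ • u) := by
  rw [← intervalIntegral.integral_smul_const]
  refine intervalIntegral.integral_congr fun t ht => ?_
  rw [uIcc_of_le hab] at ht
  exact radialMap_smul_direction hq (quantile₁_of_nonpos ρ le_rfl) hu (ha.trans ht.1)

lemma superquantile_radialMap (hq : 0 < q) (h : IsFullHalfLine ρ) {u : Vec d}
    (h0 : 0 < pNorm q u) (h1 : pNorm q u < 1) :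
    superquantile q (radialMap q (quantile₁ ρ)) u =
      superquantile₁ ρ (pNorm q u) • compPow (q - 1) ((pNorm q u)⁻¹ • u) := by
  rw [superquantile, intervalIntegral_radialMap hq (ne_zero_of_pNorm_pos hq h0) h0.le h1.le,
    h.superquantile₁_eq h0 h1, smul_smul]

lemma expectedShortfall_radialMap (hq : 0 < q) (h : IsFullHalfLine ρ) {u : Vec d}
    (h0 : 0 < pNorm q u) (h1 : pNorm q u < 1) :
    expectedShortfall q (radialMap q (quantile₁ ρ)) u =
      expectedShortfall₁ ρ (pNorm q u) • compPow (q - 1) ((pNorm q u)⁻¹ • u) := by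
  rw [expectedShortfall, intervalIntegral_radialMap hq (ne_zero_of_pNorm_pos hq h0) le_rfl h0.le,
    h.expectedShortfall₁_eq h0 h1, smul_smul]

/-- The ray integrals only depend on the map up to null sets of the ray. -/
lemma superquantile_congr {Q Q' : Vec d → Vec d} {u : Vec d} (h0 : 0 ≤ pNorm q u)
    (h1 : pNorm q u ≤ 1)
    (h : ∀ᵐ t ∂volume.restrict (Icc (0 : ℝ) 1),
      Q' (t • (pNorm q u)⁻¹ • u) = Q (t • (pNorm q u)⁻¹ • u)) :
    superquantile q Q' u = superquantile q Q u ∧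
      expectedShortfall q Q' u = expectedShortfall q Q u := by
  rw [ae_restrict_iff' measurableSet_Icc] at h
  constructor
  · rw [superquantile, superquantile]
    congr 1
    refine intervalIntegral.integral_congr_ae ?_
    filter_upwards [h] with t ht hmem
    rw [uIoc_of_le h1] at hmem
    exact ht ⟨h0.trans hmem.1.le, hmem.2⟩
  · rw [expectedShortfall, expectedShortfall]
    congr 1
    refine intervalIntegral.integral_congr_ae ?_
    filter_upwards [h] with t ht hmem
    rw [uIoc_of_le h0] at hmem
    exact ht ⟨hmem.1.le, hmem.2.trans h1⟩

end Shortfall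

end MK

theorem mainTheorem6 {d : ℕ} (hd : 1 ≤ d) (p q : ℝ) (hp : 1 < p) (hq : q = p / (p - 1))
    {Ω : Type*} [MeasurableSpace Ω] (P : Measure Ω) [IsProbabilityMeasure P]
    (X : Ω → MK.Vec d)
    (hind : iIndepFun (fun (i : Fin d) (ω : Ω) => X ω i) P)
    (hlaw : ∀ i, HasLaw (fun ω => X ω i) (MK.genGammaLaw p) P)
    -- the law of `X`, the reference distribution, and the law of `‖X‖_p`
    (ν μ : Measure (MK.Vec d)) (ρ : Measure ℝ)
    (hν : ν = P.map X) (hμ : μ = MK.conjSphericalPos d q)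
    (hρ : ρ = P.map fun ω => MK.pNorm p (X ω))
    -- the explicit maps
    (F Q : MK.Vec d → MK.Vec d)
    (hF : F = fun x => cdf ρ (MK.pNorm p x) • MK.compPow (p - 1) ((MK.pNorm p x)⁻¹ • x))
    (hQ : Q = fun u => MK.quantile₁ ρ (MK.pNorm q u) •
      MK.compPow (q - 1) ((MK.pNorm q u)⁻¹ • u)) :
    -- `F` is the MK distribution function
    (MK.IsMKDistribution μ ν F ∧ ∀ F', MK.IsMKQuantile ν μ F' → F' =ᵐ[ν] F) ∧
    -- `Q` is the MK quantile function
    (MK.IsMKQuantile μ ν Q ∧ ∀ Q', MK.IsMKQuantile μ ν Q' → Q' =ᵐ[μ] Q) ∧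
    -- `Q` is everywhere the gradient of one convex potential on the `q`-unit ball
    (∃ ψ : MK.Vec d → ℝ, ConvexOn ℝ {u | MK.pNorm q u < 1} ψ ∧ ψ 0 = 0 ∧
      ∀ u ∈ MK.orthant d, 0 < MK.pNorm q u → MK.pNorm q u < 1 → HasGradientAt ψ (Q u) u) ∧
    -- `F` and `Q` are inverse to each other
    (MapsTo F {x | x ∈ MK.orthant d ∧ x ≠ 0}
        {u | u ∈ MK.orthant d ∧ 0 < MK.pNorm q u ∧ MK.pNorm q u < 1} ∧
      MapsTo Q {u | u ∈ MK.orthant d ∧ 0 < MK.pNorm q u ∧ MK.pNorm q u < 1}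
        {x | x ∈ MK.orthant d ∧ x ≠ 0} ∧
      InvOn Q F {x | x ∈ MK.orthant d ∧ x ≠ 0}
        {u | u ∈ MK.orthant d ∧ 0 < MK.pNorm q u ∧ MK.pNorm q u < 1}) ∧
    -- superquantile and expected shortfall, with convergent integrals
    (∀ u ∈ MK.orthant d, 0 < MK.pNorm q u → MK.pNorm q u < 1 →
      IntervalIntegrable (fun t : ℝ => Q (t • (MK.pNorm q u)⁻¹ • u)) volume 0 1 ∧
      MK.superquantile q Q u = MK.superquantile₁ ρ (MK.pNorm q u) •
        MK.compPow (q - 1) ((MK.pNorm q u)⁻¹ • u) ∧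
      MK.expectedShortfall q Q u = MK.expectedShortfall₁ ρ (MK.pNorm q u) •
        MK.compPow (q - 1) ((MK.pNorm q u)⁻¹ • u)) ∧
    -- on the unit sphere the expected shortfall has the mean of `‖X‖_p` as its radial part
    (∀ u ∈ MK.orthant d, MK.pNorm q u = 1 →
      IntervalIntegrable (fun t : ℝ => Q (t • u)) volume 0 1 ∧
      Integrable (fun y : ℝ => y) ρ ∧
      MK.expectedShortfall q Q u = (∫ y, y ∂ρ) • MK.compPow (q - 1) u) ∧
    -- the same formulas, almost everywhere, for any other version of the MK quantile function
    (∀ Q', MK.IsMKQuantile μ ν Q' → ∀ᵐ u ∂μ,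
      IntervalIntegrable (fun t : ℝ => Q' (t • (MK.pNorm q u)⁻¹ • u)) volume 0 1 ∧
      MK.superquantile q Q' u = MK.superquantile₁ ρ (MK.pNorm q u) •
        MK.compPow (q - 1) ((MK.pNorm q u)⁻¹ • u) ∧
      MK.expectedShortfall q Q' u = MK.expectedShortfall₁ ρ (MK.pNorm q u) •
        MK.compPow (q - 1) ((MK.pNorm q u)⁻¹ • u)) := by
  -- the law of `X` has a radial density, whence all properties of the norm and the direction
  have hp0 : 0 < p := by linarith
  have hpq : p.HolderConjugate q := hq ▸ Real.HolderConjugate.conjExponent hp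
  have hq1 : 1 < q := hpq.symm.lt
  have hq0 : 0 < q := hpq.symm.pos
  have hXm : AEMeasurable X P := MK.aemeasurable_of_hasLaw hlaw
  have hprob : IsProbabilityMeasure ν := hν ▸ Measure.isProbabilityMeasure_map hXm
  set g : ℝ → ENNReal := fun r =>
    ENNReal.ofReal ((p / Real.Gamma p⁻¹) ^ d * Real.exp (-r ^ p))
  have hg : Measurable g := by fun_prop
  have hg0 : ∀ r, g r ≠ 0 := fun r => (ENNReal.ofReal_pos.2
    (mul_pos (pow_pos (MK.genGamma_const_pos hp) d) (Real.exp_pos _))).ne'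
  have hdens : ν = (volume.restrict (MK.orthant d)).withDensity fun x => g (MK.pNorm p x) :=
    hν.trans (MK.map_eq_withDensity_pNorm hp hind hlaw)
  have hm := MK.measurable_pNorm (d := d) hp0
  have hρν : ρ = ν.map (MK.pNorm p) := by
    rw [hρ, hν, AEMeasurable.map_map_of_aemeasurable hm.aemeasurable hXm]
    rfl
  have hfull : MK.IsFullHalfLine ρ := hρν ▸ MK.isFullHalfLine_map_pNorm hd hp0 hg hg0 hdens
  have hF' : F = MK.radialMap p (cdf ρ) := hF
  have hQ' : Q = MK.radialMap q (MK.quantile₁ ρ) := hQ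
  have hFm : Measurable F := hF' ▸ MK.measurable_radialMap hp0 (monotone_cdf ρ).measurable
  have hQm : Measurable Q := hQ' ▸ MK.measurable_radialMap hq0 hfull.measurable_quantile₁
  have hFmap : ν.map F = μ := by
    rw [hF', hμ, hρν, MK.map_radialMap_cdf hd hp hq hg hg0 hdens]
  have hμprob : IsProbabilityMeasure μ := hFmap ▸ Measure.isProbabilityMeasure_map hFm.aemeasurable
  -- first moments
  have hXi : ∀ i, Integrable (fun ω => X ω i) P := fun i => by
    have h1 := MK.integrable_id_genGammaLaw hp
    rw [← (hlaw i).map_eq] at h1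
    exact h1.comp_aemeasurable (hlaw i).aemeasurable
  have hXs : Integrable (fun ω => ∑ i, |X ω i|) P := integrable_finsetSum _ fun i _ => (hXi i).abs
  have hνi : Integrable (fun x => ‖x‖) ν := by
    rw [hν, integrable_map_measure (by fun_prop) hXm]
    refine hXs.mono' (by fun_prop) (ae_of_all _ fun ω => ?_)
    simpa using MK.norm_le_sum_abs (X ω)
  have hρi : Integrable (fun y : ℝ => y) ρ := by
    rw [hρ]
    refine (integrable_map_measure (f := fun ω => MK.pNorm p (X ω)) aestronglyMeasurable_id
      (hm.comp_aemeasurable hXm)).2 ?_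
    refine hXs.mono' (hm.comp_aemeasurable hXm).aestronglyMeasurable (ae_of_all _ fun ω => ?_)
    rw [Function.comp_apply, id, Real.norm_of_nonneg (MK.pNorm_nonneg _ _)]
    exact MK.pNorm_le_sum hp.le (X ω)
  -- the pointwise inversion formulas
  have hF_props : ∀ x, x ≠ 0 → MK.pNorm q (F x) = cdf ρ (MK.pNorm p x) ∧ Q (F x) = x ∧
      (F x ∈ MK.orthant d ↔ x ∈ MK.orthant d) := fun x hx => by
    have h1 := MK.pNorm_pos hp0 hx
    have h2 := hfull.cdf_pos h1
    rw [hF', hQ']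
    exact ⟨MK.pNorm_radialMap hpq hx h2, MK.radialMap_radialMap hpq hx h2 (hfull.quantile₁_cdf h1.le),
      MK.radialMap_mem_orthant hp0 hx h2⟩
  have hQ_props : ∀ u, 0 < MK.pNorm q u → MK.pNorm q u < 1 → Q u ≠ 0 ∧ F (Q u) = u ∧
      (Q u ∈ MK.orthant d ↔ u ∈ MK.orthant d) := fun u h0 h1 => by
    have h2 := hfull.quantile₁_pos h0 h1
    have hu := MK.ne_zero_of_pNorm_pos hq0 h0
    rw [hF', hQ']
    refine ⟨MK.ne_zero_of_pNorm_pos hp0 ?_, MK.radialMap_radialMap hpq.symm hu h2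
      (hfull.cdf_quantile₁ h0.le h1), MK.radialMap_mem_orthant hq0 hu h2⟩
    rwa [MK.pNorm_radialMap hpq.symm hu h2]
  have hν_ae : ∀ᵐ x ∂ν, x ∈ MK.orthant d ∧ 0 < MK.pNorm p x :=
    MK.ae_mem_orthant_and_pNorm_pos hd hp0 hg hg0 hdens
  have hμ_ae : ∀ᵐ u ∂μ, 0 < MK.pNorm q u ∧ MK.pNorm q u < 1 := by
    have hms : MeasurableSet {u : MK.Vec d | 0 < MK.pNorm q u ∧ MK.pNorm q u < 1} :=
      (MK.measurable_pNorm hq0) measurableSet_Ioo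
    rw [← hFmap, ae_map_iff hFm.aemeasurable hms]
    filter_upwards [hν_ae] with x hx
    rw [(hF_props x (MK.ne_zero_of_pNorm_pos hp0 hx.2)).1]
    exact ⟨hfull.cdf_pos hx.2, hfull.cdf_lt_one _⟩
  have hμb : ∀ᵐ u ∂μ, ‖u‖ ≤ d := by
    filter_upwards [hμ_ae] with u hu
    refine (MK.norm_le_mul_pNorm hq0 u).trans ?_
    exact mul_le_of_le_one_right (Nat.cast_nonneg d) hu.2.le
  have hQF : ∀ᵐ x ∂ν, Q (F x) = x := by
    filter_upwards [hν_ae] with x hx using (hF_props x (MK.ne_zero_of_pNorm_pos hp0 hx.2)).2.1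
  have hFQ : ∀ᵐ u ∂μ, F (Q u) = u := by
    filter_upwards [hμ_ae] with u hu using (hQ_props u hu.1 hu.2).2.1
  have hQmap : μ.map Q = ν := by
    have hid : Q ∘ F =ᵐ[ν] id := hQF
    rw [← hFmap, Measure.map_map hQm hFm, Measure.map_congr hid, Measure.map_id]
  -- the radial potentials
  have hball : IsOpen {u : MK.Vec d | MK.pNorm q u < 1} :=
    isOpen_lt (MK.continuous_pNorm hq0) continuous_const
  have hψ : ConvexOn ℝ {u : MK.Vec d | MK.pNorm q u < 1}
      (fun u => ∫ s in (0 : ℝ)..MK.pNorm q u, MK.quantile₁ ρ s) :=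
    MK.convexOn_comp_pNorm hq1.le (hfull.convexOn_integral_quantile₁ hρi)
      (hfull.monotoneOn_integral_quantile₁ hρi) (MK.convex_pNorm_lt hq1.le 1)
      fun u hu => ⟨MK.pNorm_nonneg _ _, hu⟩
  have hψ' : ∀ u : MK.Vec d, 0 < MK.pNorm q u → MK.pNorm q u < 1 →
      HasGradientAt (fun u => ∫ s in (0 : ℝ)..MK.pNorm q u, MK.quantile₁ ρ s) (Q u) u :=
    fun u h0 h1 => hQ' ▸ MK.hasGradientAt_comp_pNorm hq1 (MK.ne_zero_of_pNorm_pos hq0 h0)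
      (hfull.hasDerivAt_integral_quantile₁ hρi h0 h1)
  have hMKQ : MK.IsMKQuantile μ ν Q := by
    refine ⟨hQm.aemeasurable, hQmap, _, _, hψ, ?_⟩
    filter_upwards [hμ_ae] with u hu
    exact ⟨hball.interior_eq.symm ▸ hu.2, hψ' u hu.1 hu.2⟩
  have hMKF : MK.IsMKQuantile ν μ F := by
    refine ⟨hFm.aemeasurable, hFmap, univ, _, MK.convexOn_comp_pNorm hp.le
      hfull.convexOn_integral_cdf (hfull.monotone_integral_cdf.monotoneOn _) convex_univ
      (mapsTo_univ _ _), ?_⟩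
    filter_upwards [hν_ae] with x hx
    refine ⟨by simp, ?_⟩
    rw [hF']
    exact MK.hasGradientAt_comp_pNorm hp (MK.ne_zero_of_pNorm_pos hp0 hx.2)
      (hfull.hasDerivAt_integral_cdf _)
  have hQuniq : ∀ Q', MK.IsMKQuantile μ ν Q' → Q' =ᵐ[μ] Q := fun Q' h =>
    hMKQ.ae_eq_of_bounded_source h hμb hνi
  have hray : ∀ u : MK.Vec d, 0 < MK.pNorm q u → MK.pNorm q u < 1 →
      IntervalIntegrable (fun t : ℝ => Q (t • (MK.pNorm q u)⁻¹ • u)) volume 0 1 ∧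
      MK.superquantile q Q u = MK.superquantile₁ ρ (MK.pNorm q u) •
        MK.compPow (q - 1) ((MK.pNorm q u)⁻¹ • u) ∧
      MK.expectedShortfall q Q u = MK.expectedShortfall₁ ρ (MK.pNorm q u) •
        MK.compPow (q - 1) ((MK.pNorm q u)⁻¹ • u) := fun u h0 h1 => by
    rw [hQ']
    exact ⟨MK.intervalIntegrable_radialMap hq0 hfull hρi (MK.ne_zero_of_pNorm_pos hq0 h0),
      MK.superquantile_radialMap hq0 hfull h0 h1, MK.expectedShortfall_radialMap hq0 hfull h0 h1⟩
  refine ⟨⟨⟨hMKF, Q, hMKQ, hFQ, hQF⟩, fun F' h => hMKF.ae_eq_of_bounded_target h hνi hμb⟩,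
    ⟨hMKQ, hQuniq⟩, ⟨_, hψ, ?_, fun u _ => hψ' u⟩, ⟨?_, ?_, ?_, ?_⟩, fun u _ => hray u, ?_, ?_⟩
  · simp [MK.pNorm_zero hq0]
  · rintro x ⟨hx, hx0⟩
    obtain ⟨h1, -, h3⟩ := hF_props x hx0
    refine ⟨h3.2 hx, ?_⟩
    rw [h1]
    exact ⟨hfull.cdf_pos (MK.pNorm_pos hp0 hx0), hfull.cdf_lt_one _⟩
  · rintro u ⟨hu, h0, h1⟩
    exact ⟨(hQ_props u h0 h1).2.2.2 hu, (hQ_props u h0 h1).1⟩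
  · rintro x ⟨-, hx0⟩
    exact (hF_props x hx0).2.1
  · rintro u ⟨-, h0, h1⟩
    exact (hQ_props u h0 h1).2.1
  · intro u _ hu
    have hu0 : u ≠ 0 := MK.ne_zero_of_pNorm_pos hq0 (hu ▸ one_pos)
    have h1 := MK.intervalIntegrable_radialMap hq0 hfull hρi hu0
    have h2 := MK.intervalIntegral_radialMap (ρ := ρ) hq0 hu0 le_rfl zero_le_one
    rw [← hQ', hfull.integral_quantile₁] at h2
    rw [← hQ'] at h1
    simp only [hu, inv_one, one_smul] at h1 h2
    refine ⟨h1, hρi, ?_⟩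
    rw [MK.expectedShortfall]
    simp only [hu, inv_one, one_smul, div_one, h2]
  · intro Q' h
    have h1 := hQuniq Q' h
    rw [hμ] at h1
    have h2 := MK.ae_ray hd hp hq hpq hg hg0 hdens h1
    rw [← hμ] at h2
    filter_upwards [h2, hμ_ae] with u h3 h4
    obtain ⟨r1, r2, r3⟩ := hray u h4.1 h4.2
    obtain ⟨c1, c2⟩ := MK.superquantile_congr h4.1.le h4.2.le h3
    refine ⟨r1.congr_ae ?_, c1.trans r2, c2.trans r3⟩
    rw [uIoc_of_le zero_le_one]
    filter_upwards [ae_restrict_of_ae_restrict_of_subset Ioc_subset_Icc_self h3] with t ht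
    exact ht.symm
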